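/- Let $n\ge 1$, let $Q$ be a real symmetric positive definite $n\times n$ matrix and let $B$ be a real $n\times n$ matrix all of whose eigenvalues have negative real part. For $0<t\le\infty$ put $Q_t=\int_0^t e^{sB}Qe^{sB^*}\,ds$; put $R(x)=\frac12\langle Q_\infty^{-1}x,x\rangle$, $D_t=Q_\infty e^{-tB^*}Q_\infty^{-1}$, $$d\gamma_\infty(x)=(2\pi)^{-n/2}(\det Q_\infty)^{-1/2}e^{-R(x)}\,dx,$$ and, for $0<t<\infty$ and $x,u\in\mathbb R^n$, let $$K_t(x,u)=\Big(\frac{\det Q_\infty}{\det Q_t}\Big)^{1/2}e^{R(x)}\exp\Big[-\tfrac12\big\langle (Q_t^{-1}-Q_\infty^{-1})(u-D_tx),\,u-D_tx\big\rangle\Big]$$ be the Mehler kernel. Let $x_0=0,x_1,x_2,\dots$ be points of $\mathbb R^n$ such that the open balls $B_j=B\big(x_j,\frac1{1+|x_j|}\big)$ are pairwise disjoint and form a maximal family with this property, i.e. each ball $B\big(x,\frac1{1+|x|}\big)$, $x\in\mathbb R^n$, meets some $B_j$. Write $aB_j$ for the concentric ball with radius multiplied by $a$. Let $\rho_j\ge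 0$ be smooth functions with $\rho_j=1$ on $3B_j$ and $\rho_j=0$ off $4B_j$, and let $\widetilde r_j$ be smooth functions with values in $[0,1]$, with $\widetilde r_j=1$ on $5B_j$ and $\widetilde r_j=0$ off $6B_j$, such that, for some constant $A$, $|\nabla\rho_j(x)|+|\nabla\widetilde r_j(x)|\le A(1+|x|)$ for all $j$ and $x$. Put $$r_j=\frac{\rho_j}{\sum_i\rho_i},\qquad \eta(x,u)=\sum_{j=0}^\infty\widetilde r_j(x)\,r_j(u).$$ Then the operator $$S^{\rm glob}f(x)=\int\sup_{0<t<\infty}K_t(x,u)\,(1-\eta(x,u))\,|f(u)|\,d\gamma_\infty(u)$$ is of weak type $(1,1)$ with respect to $\gamma_\infty$: there is a constant $C<\infty$ depending only on $n$, $Q$ and $B$ such that $$\gamma_\infty\{x\in\mathbb R^n: S^{\rm glob}f(x)>\alpha\}\le\frac C\alpha\,\|f\|_{L^1(\gamma_\infty)}$$ for all $f\in L^1(\gamma_\infty)$ and all $\alpha>0$. -/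

import Mathlib

open scoped ENNReal NNReal ContDiff

noncomputable section

namespace OrnsteinUhlenbeck

open MeasureTheory

/-- Euclidean space `ℝⁿ`, with the Euclidean norm and Lebesgue measure `volume`. -/
abbrev Rn (n : ℕ) : Type := EuclideanSpace ℝ (Fin n)

variable {n : ℕ}

/-- The matrix action `A x` on Euclidean space. -/
def act (A : Matrix (Fin n) (Fin n) ℝ) (x : Rn n) : Rn n := Matrix.toEuclideanLin A x

/-- The integrand `e^{sB} Q e^{sB*}`; for a real matrix the adjoint is the transpose. -/
def covIntegrand (Q B : Matrix (Fin n) (Fin n) ℝ) (s : ℝ) : Matrix (Fin n) (Fin n) ℝ :=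
  NormedSpace.exp (s • B) * Q * NormedSpace.exp (s • B.transpose)

/-- `Q_t = ∫₀ᵗ e^{sB} Q e^{sB*} ds` for finite `t`, integrated entrywise. -/
def covT (Q B : Matrix (Fin n) (Fin n) ℝ) (t : ℝ) : Matrix (Fin n) (Fin n) ℝ :=
  Matrix.of fun i j => ∫ s in (0 : ℝ)..t, covIntegrand Q B s i j

/-- `Q_∞ = ∫₀^∞ e^{sB} Q e^{sB*} ds`, integrated entrywise. -/
def covInf (Q B : Matrix (Fin n) (Fin n) ℝ) : Matrix (Fin n) (Fin n) ℝ :=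
  Matrix.of fun i j => ∫ s in Set.Ioi (0 : ℝ), covIntegrand Q B s i j

/-- The quadratic form `R(x) = ½ ⟨Q_∞⁻¹ x, x⟩`. -/
def quadR (Q B : Matrix (Fin n) (Fin n) ℝ) (x : Rn n) : ℝ :=
  (1 / 2 : ℝ) * inner ℝ (act (covInf Q B)⁻¹ x) x

/-- The invariant measure
`dγ_∞(x) = (2π)^{-n/2} (det Q_∞)^{-1/2} exp (-R(x)) dx`. -/
def gammaInf (Q B : Matrix (Fin n) (Fin n) ℝ) : Measure (Rn n) :=
  (volume : Measure (Rn n)).withDensity fun x => ENNReal.ofReal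
    ((2 * Real.pi) ^ (-(n : ℝ) / 2) * (covInf Q B).det ^ (-(1 / 2) : ℝ) *
      Real.exp (-quadR Q B x))

/-- The one-parameter group `D_t = Q_∞ e^{-tB*} Q_∞⁻¹`. -/
def matD (Q B : Matrix (Fin n) (Fin n) ℝ) (t : ℝ) : Matrix (Fin n) (Fin n) ℝ :=
  covInf Q B * NormedSpace.exp ((-t) • B.transpose) * (covInf Q B)⁻¹

/-- The Mehler kernel `K_t(x,u)`, `t > 0`, i.e. the integral kernel of the Ornstein–Uhlenbeck
semigroup with respect to the invariant measure. -/
def mehlerKernel (Q B : Matrix (Fin n) (Fin n) ℝ) (t : ℝ) (x u : Rn n) : ℝ :=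
  ((covInf Q B).det / (covT Q B t).det) ^ (1 / 2 : ℝ) * Real.exp (quadR Q B x) *
    Real.exp (-(1 / 2 : ℝ) *
      inner ℝ (act ((covT Q B t)⁻¹ - (covInf Q B)⁻¹) (u - act (matD Q B t) x))
        (u - act (matD Q B t) x))

/-- The ball `a B(c, 1 / (1 + |c|))`, scaled concentrically by the factor `a`. -/
def scaledBall (a : ℝ) (c : Rn n) : Set (Rn n) := Metric.ball c (a / (1 + ‖c‖))

/-- The data from which the localizing function `η` is built: a maximal sequence of pairwise
disjoint balls `B_j = B(x_j, 1 / (1 + |x_j|))` with `x_0 = 0`, and smooth cutoff functions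
`ρ_j` (equal to `1` on `3B_j`, vanishing off `4B_j`) and `r̃_j` (with values in `[0, 1]`, equal to
`1` on `5B_j`, vanishing off `6B_j`) whose gradients are bounded by a constant times `1 + |x|`. -/
structure Localization (n : ℕ) where
  /-- the centers `x_j` -/
  center : ℕ → Rn n
  center_zero : center 0 = 0
  disjoint_balls : Pairwise fun i j =>
    Disjoint (scaledBall 1 (center i)) (scaledBall 1 (center j))
  /-- maximality: no further ball of this type is disjoint from all the `B_j` -/
  maximal : ∀ x : Rn n, ∃ j, ¬ Disjoint (scaledBall 1 x) (scaledBall 1 (center j))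
  /-- the inner cutoffs `ρ_j` -/
  rho : ℕ → Rn n → ℝ
  rho_smooth : ∀ j, ContDiff ℝ ∞ (rho j)
  rho_nonneg : ∀ j x, 0 ≤ rho j x
  rho_eq_one : ∀ j, ∀ x ∈ scaledBall 3 (center j), rho j x = 1
  rho_support : ∀ j, Function.support (rho j) ⊆ scaledBall 4 (center j)
  rho_grad : ∃ A : ℝ, ∀ j x, ‖gradient (rho j) x‖ ≤ A * (1 + ‖x‖)
  /-- the outer cutoffs `r̃_j` -/
  outer : ℕ → Rn n → ℝ
  outer_smooth : ∀ j, ContDiff ℝ ∞ (outer j)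
  outer_mem : ∀ j x, outer j x ∈ Set.Icc (0 : ℝ) 1
  outer_eq_one : ∀ j, ∀ x ∈ scaledBall 5 (center j), outer j x = 1
  outer_support : ∀ j, Function.support (outer j) ⊆ scaledBall 6 (center j)
  outer_grad : ∃ A : ℝ, ∀ j x, ‖gradient (outer j) x‖ ≤ A * (1 + ‖x‖)

/-- The partition of unity `r_j = ρ_j / ∑ᵢ ρ_i`; the sum is locally finite. -/
def Localization.part (L : Localization n) (j : ℕ) (u : Rn n) : ℝ :=
  L.rho j u / ∑' i, L.rho i u

/-- `η(x,u) = ∑_j r̃_j(x) r_j(u)`; all but finitely many terms vanish. -/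
def Localization.eta (L : Localization n) (x u : Rn n) : ℝ :=
  ∑' j, L.outer j x * L.part j u

/-- The operator `S^glob f(x) = ∫ sup_{0<t<∞} K_t(x,u) (1 - η(x,u)) |f(u)| dγ_∞(u)`. The supremum
and the integral of nonnegative quantities are taken in `[0, ∞]`. -/
def Sglob (Q B : Matrix (Fin n) (Fin n) ℝ) (L : Localization n) (f : Rn n → ℂ) (x : Rn n) :
    ℝ≥0∞ :=
  ∫⁻ u, (⨆ t : Set.Ioi (0 : ℝ), ENNReal.ofReal (mehlerKernel Q B t x u)) *
    ENNReal.ofReal (1 - L.eta x u) * ‖f u‖ₑ ∂(gammaInf Q B)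

/-- An operator `T`, defined on `L¹(μ)` with values in the `[0, ∞]`-valued functions, is of weak type
`(1,1)` with respect to `μ`, with constant `C`:
`μ {x : T f(x) > α} ≤ (C / α) ‖f‖_{L¹(μ)}` for all `f ∈ L¹(μ)` and `α > 0`. -/
def IsWeakType11 (μ : Measure (Rn n)) (T : (Rn n → ℂ) → Rn n → ℝ≥0∞) (C : ℝ≥0) : Prop :=
  ∀ f : Rn n → ℂ, MemLp f 1 μ → ∀ α : ℝ, 0 < α →
    μ {x | ENNReal.ofReal α < T f x} ≤ C / ENNReal.ofReal α * eLpNorm f 1 μ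

end OrnsteinUhlenbeck

end

/-! Write R for the quadratic form. In the variable v = D_{-t}u - x the Mehler exponent is a sum of
two nonnegative forms and dominates |v|²/min(1,t) (`inner_mehler_exponent`,
`exists_mehler_exponent_ge`). Hence both K_t min(1,t)^{n/2} and K_t |D_{-t}u - x|^n are O(e^{R(x)}),
for all t > 0 at once (`exists_mehlerKernel_le`). Where η ≠ 1, the points x and u are at distance ≳
1/(1+|x|), so either t ≳ (1+|x|)^{-2} or D_{-t}u stays ≳ 1/(1+|x|) away from x. For R(x) ≤ 4r², r ≥
1, the kernel is therefore at most C e^{R(x)} sup_t (1/r + |D_{-t}u - x|)^{-n}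
(`exists_kernel_bounds`).

By homogeneity |f| dγ_∞ may be replaced by a probability measure ν. At a large level a only the
shell R(x) ~ r² ~ log a matters: below it the kernel is too small to reach a, and beyond it the
Gaussian mass is O(1/a). Small levels are trivial because the total mass is finite.

On the shell let G(x) = ∫ sup_t (1/r + |D_{-t}u - x|)^{-n} dν(u). Two estimates with opposite powers
of r meet. (i) ∫_{|z|~r} G ≤ C r². The curve D_{-t}u has speed ~ r in the annulus, so the supremum
is controlled by r times a time integral of (1/r + |D_{-t}u - z|)^{-n-1}; integration in z yields
another factor r, and the curve spends bounded time in the annulus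
(`exists_lintegral_tubeKernel_le`). (ii) Average the Gaussian measure of {e^R G > a} over the flow
D_s, 0 ≤ s ≤ 1. Along an orbit G(D_s z) ≤ K G(z), while R grows at rate ≳ r². So e^{-R} ≤ K G(z)/a
at the first point of the level set and decays at rate r² afterwards, and the orbit contributes
O(G(z)/(a r²)). Integrating (ii) in z by means of (i) gives C/a (`exists_weight_levelSet_le`). -/

/-! ### Exponential decay of e^{tB} from the spectral condition. -/

open scoped Matrix.Norms.L2Operator in
theorem Matrix.exp_mulVec_of_mulVec_eq {ι : Type*} [Fintype ι] [DecidableEq ι]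
    (A : Matrix ι ι ℂ) (v : ι → ℂ) (z : ℂ) (h : A.mulVec v = z • v) :
    (NormedSpace.exp A).mulVec v = Complex.exp z • v := by
  have hpow : ∀ k : ℕ, (A ^ k).mulVec v = z ^ k • v := by
    intro k
    induction k with
    | zero => simp
    | succ k ih =>
      rw [pow_succ', ← Matrix.mulVec_mulVec, ih, Matrix.mulVec_smul, h, smul_smul, pow_succ]
  have h1 := NormedSpace.exp_series_hasSum_exp' (𝕂 := ℂ) A
  have h2 := NormedSpace.exp_series_hasSum_exp' (𝕂 := ℂ) z
  have h3 := h1.map (Matrix.mulVec.addMonoidHomLeft v) (by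
    change Continuous fun M : Matrix ι ι ℂ => M.mulVec v
    fun_prop)
  have h4 := h2.smul_const v
  rw [← Complex.exp_eq_exp_ℂ] at h4
  refine h3.unique (h4.congr_fun ?_)
  intro k
  simp [Matrix.mulVec.addMonoidHomLeft, Matrix.smul_mulVec, hpow, smul_smul]

open scoped Matrix.Norms.L2Operator in
-- A commutes with its exponential, so it preserves each eigenspace of the latter and has an
-- eigenvector there; its eigenvalue z must satisfy e^z = μ.
theorem Matrix.exists_mem_spectrum_of_mem_spectrum_exp {ι : Type*} [Fintype ι] [DecidableEq ι]
    (A : Matrix ι ι ℂ) (μ : ℂ) (hμ : μ ∈ spectrum ℂ (NormedSpace.exp A)) :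
    ∃ z ∈ spectrum ℂ A, μ = Complex.exp z := by
  have hcomm : Commute (Matrix.toLin' A) (Matrix.toLin' (NormedSpace.exp A)) := by
    have : A * NormedSpace.exp A = NormedSpace.exp A * A :=
      ((Commute.refl A).exp_right).eq
    change _ * _ = _ * _
    rw [Module.End.mul_eq_comp, Module.End.mul_eq_comp, ← Matrix.toLin'_mul,
      ← Matrix.toLin'_mul, this]
  rw [← Matrix.spectrum_toLin', ← Module.End.hasEigenvalue_iff_mem_spectrum] at hμ
  have hmaps := Module.End.mapsTo_genEigenspace_of_comm hcomm.symm μ 1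
  have : Nontrivial (Module.End.eigenspace (Matrix.toLin' (NormedSpace.exp A)) μ) :=
    Submodule.nontrivial_iff_ne_bot.2 hμ
  obtain ⟨z, hz⟩ := Module.End.exists_eigenvalue ((Matrix.toLin' A).restrict hmaps)
  obtain ⟨w, hw⟩ := hz.exists_hasEigenvector
  have hw1 : A.mulVec w.1 = z • w.1 := by
    have : Matrix.toLin' A w.1 = z • w.1 := congrArg Subtype.val hw.apply_eq_smul
    simpa using this
  have hw0 : w.1 ≠ 0 := fun h => hw.2 (Subtype.ext h)
  refine ⟨z, ?_, ?_⟩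
  · rw [← Matrix.spectrum_toLin', ← Module.End.hasEigenvalue_iff_mem_spectrum]
    exact Module.End.hasEigenvalue_of_hasEigenvector (x := w.1)
      ⟨Module.End.mem_eigenspace_iff.2 (by simpa using hw1), hw0⟩
  · have h1 := Matrix.exp_mulVec_of_mulVec_eq A w.1 z hw1
    have h2 : (NormedSpace.exp A).mulVec w.1 = μ • w.1 := by
      simpa using Module.End.mem_eigenspace_iff.1 w.2
    rw [h2] at h1
    exact smul_left_injective ℂ hw0 h1

open scoped Matrix.Norms.L2Operator in
-- The spectral radius of e^A is below 1, and Gelfand's formula turns this into a norm bound for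
-- some power.
theorem Matrix.exists_norm_exp_pow_lt_one {ι : Type*} [Fintype ι] [DecidableEq ι] [Nonempty ι]
    (A : Matrix ι ι ℂ) (hA : ∀ z ∈ spectrum ℂ A, z.re < 0) :
    ∃ k : ℕ, 0 < k ∧ ‖(NormedSpace.exp A) ^ k‖ < 1 := by
  have hr : spectralRadius ℂ (NormedSpace.exp A) < 1 := by
    have := spectrum.spectralRadius_lt_of_forall_lt (NormedSpace.exp A) (r := 1) (by
      intro μ hμ
      obtain ⟨z, hz, rfl⟩ := A.exists_mem_spectrum_of_mem_spectrum_exp μ hμ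
      rw [← NNReal.coe_lt_coe, coe_nnnorm, Complex.norm_exp]
      simpa using hA z hz)
    simpa using this
  have ht := spectrum.pow_nnnorm_pow_one_div_tendsto_nhds_spectralRadius (NormedSpace.exp A)
  obtain ⟨k, hk, hk0⟩ := ((ht.eventually_lt_const hr).and (Filter.eventually_gt_atTop 0)).exists
  refine ⟨k, hk0, ?_⟩
  have h1 : (‖NormedSpace.exp A ^ k‖₊ : ℝ≥0∞) < 1 := by
    by_contra hcon
    exact absurd (ENNReal.one_le_rpow (not_lt.1 hcon) (by positivity)) (not_le.2 hk)
  exact_mod_cast h1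

open scoped Matrix.Norms.L2Operator in
-- Brings the contraction estimate, proved over ℂ where eigenvectors exist, back to the real matrix.
theorem Matrix.norm_le_norm_map_ofReal {ι : Type*} [Fintype ι] [DecidableEq ι]
    (A : Matrix ι ι ℝ) : ‖A‖ ≤ ‖A.map (fun r : ℝ => (r : ℂ))‖ := by
  rw [Matrix.l2_opNorm_def]
  refine ContinuousLinearMap.opNorm_le_bound _ (norm_nonneg _) fun x => ?_
  have h := Matrix.l2_opNorm_mulVec (A.map (fun r : ℝ => (r : ℂ)))
    (WithLp.toLp 2 fun i => (x i : ℂ))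
  have h1 : ‖(WithLp.toLp 2 fun i => (x i : ℂ) : EuclideanSpace ℂ ι)‖ = ‖x‖ := by
    simp [EuclideanSpace.norm_eq]
  rw [h1] at h
  refine le_trans (le_of_eq ?_) h
  simp only [EuclideanSpace.norm_eq]
  congr 1
  refine Finset.sum_congr rfl fun i _ => ?_
  congr 1
  rw [← Complex.norm_real]
  congr 1
  simp [Matrix.toLpLin_apply, Matrix.mulVec, dotProduct]

open scoped Matrix.Norms.L2Operator in
theorem Matrix.exists_norm_exp_smul_le {ι : Type*} [Fintype ι] [DecidableEq ι] [Nonempty ι]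
    (B : Matrix ι ι ℝ)
    (hB : ∀ z ∈ spectrum ℂ (B.map (fun r : ℝ => (r : ℂ))), z.re < 0) :
    ∃ M δ : ℝ, 0 < δ ∧ ∀ t : ℝ, 0 ≤ t →
      ‖NormedSpace.exp (t • B)‖ ≤ M * Real.exp (-δ * t) := by
  let _ : NormedAlgebra ℚ (Matrix ι ι ℝ) := NormedAlgebra.restrictScalars ℚ ℝ (Matrix ι ι ℝ)
  obtain ⟨k, hk, hlt⟩ := Matrix.exists_norm_exp_pow_lt_one _ hB
  have hq : ‖NormedSpace.exp ((k : ℝ) • B)‖ < 1 := by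
    refine lt_of_le_of_lt (Matrix.norm_le_norm_map_ofReal _) (lt_of_eq_of_lt ?_ hlt)
    congr 1
    have h1 : (NormedSpace.exp ((k : ℝ) • B)) = NormedSpace.exp B ^ k := by
      rw [← Matrix.exp_nsmul, Nat.cast_smul_eq_nsmul]
    have h2 := NormedSpace.map_exp ((Complex.ofRealHom).mapMatrix (m := ι)) (by
      change Continuous fun M : Matrix ι ι ℝ => M.map Complex.ofRealHom
      exact continuous_id.matrix_map Complex.continuous_ofReal) B
    rw [h1]
    change (Complex.ofRealHom).mapMatrix (NormedSpace.exp B ^ k) = _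
    rw [map_pow, h2]
    rfl
  -- The maximum with 1/2 gives q > 0 without further argument, so that log q can serve as the decay
  -- rate. The factor q⁻¹ in the constant pays for rounding t/k down.
  set q := max ‖NormedSpace.exp ((k : ℝ) • B)‖ (1 / 2) with hqdef
  have hq0 : 0 < q := lt_of_lt_of_le (by norm_num) (le_max_right _ _)
  have hq1 : q < 1 := max_lt hq (by norm_num)
  have hk' : (0 : ℝ) < k := by exact_mod_cast hk
  have hcont : Continuous fun s : ℝ => ‖NormedSpace.exp (s • B)‖ :=
    (NormedSpace.exp_continuous.comp (continuous_id.smul continuous_const)).norm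
  obtain ⟨S, hS⟩ := (isCompact_Icc (a := (0 : ℝ)) (b := k)).bddAbove_image hcont.continuousOn
  have hS' : ∀ s ∈ Set.Icc (0 : ℝ) k, ‖NormedSpace.exp (s • B)‖ ≤ S := fun s hs =>
    hS (Set.mem_image_of_mem _ hs)
  have hS0 : 0 ≤ S := (norm_nonneg _).trans (hS' 0 ⟨le_rfl, hk'.le⟩)
  have hlogq : Real.log q < 0 := Real.log_neg hq0 hq1
  refine ⟨S * q⁻¹, -Real.log q / k, by have := neg_pos.2 hlogq; positivity, fun t ht => ?_⟩
  set m := ⌊t / k⌋₊ with hm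
  have hm1 : (m : ℝ) ≤ t / k := Nat.floor_le (by positivity)
  have hm2 : t / k < m + 1 := Nat.lt_floor_add_one _
  rw [le_div_iff₀ hk'] at hm1
  rw [div_lt_iff₀ hk'] at hm2
  have hsplit : NormedSpace.exp (t • B) =
      NormedSpace.exp ((k : ℝ) • B) ^ m * NormedSpace.exp ((t - m * k) • B) := by
    rw [← Matrix.exp_nsmul, ← Matrix.exp_add_of_commute]
    · congr 1
      rw [← Nat.cast_smul_eq_nsmul ℝ, smul_smul, ← add_smul]
      congr 1; ring
    · exact (((Commute.refl B).smul_left _).smul_right _).smul_left _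
  rw [hsplit]
  have hpow : ‖NormedSpace.exp ((k : ℝ) • B) ^ m‖ ≤ q ^ m :=
    (norm_pow_le _ _).trans (pow_le_pow_left₀ (norm_nonneg _) (le_max_left _ _) _)
  have hqm : q ^ m ≤ q⁻¹ * Real.exp (-(-Real.log q / k) * t) := by
    have : q ^ m = Real.exp (m * Real.log q) := by
      rw [← Real.rpow_natCast, Real.rpow_def_of_pos hq0, mul_comm]
    rw [this]
    nth_rewrite 2 [← Real.exp_log hq0]
    rw [← Real.exp_neg, ← Real.exp_add]
    apply Real.exp_le_exp.2
    have : -(-Real.log q / k) * t = Real.log q * (t / k) := by ring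
    rw [this]
    have h3 : t / k < m + 1 := Nat.lt_floor_add_one _
    nlinarith
  calc _ ≤ q ^ m * S := (norm_mul_le _ _).trans
        (mul_le_mul hpow (hS' _ ⟨by linarith, by linarith⟩) (norm_nonneg _) (by positivity))
    _ ≤ (q⁻¹ * Real.exp (-(-Real.log q / k) * t)) * S := by gcongr
    _ = _ := by ring

noncomputable section

namespace OrnsteinUhlenbeck

open MeasureTheory
open scoped Matrix.Norms.L2Operator

variable {n : ℕ}

/-! ### Matrix action and positive definite forms. -/

theorem act_eq_toEuclideanCLM (A : Matrix (Fin n) (Fin n) ℝ) (x : Rn n) :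
    act A x = Matrix.toEuclideanCLM (𝕜 := ℝ) A x := rfl

theorem act_mul (A A' : Matrix (Fin n) (Fin n) ℝ) (x : Rn n) :
    act (A * A') x = act A (act A' x) := by
  simp [act_eq_toEuclideanCLM]

theorem act_one (x : Rn n) : act 1 x = x := by
  simp [act_eq_toEuclideanCLM]

theorem act_add_matrix (A A' : Matrix (Fin n) (Fin n) ℝ) (x : Rn n) :
    act (A + A') x = act A x + act A' x := by
  simp [act_eq_toEuclideanCLM]

theorem act_sub_matrix (A A' : Matrix (Fin n) (Fin n) ℝ) (x : Rn n) :
    act (A - A') x = act A x - act A' x := by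
  simp [act_eq_toEuclideanCLM]

theorem act_sub (A : Matrix (Fin n) (Fin n) ℝ) (x y : Rn n) :
    act A (x - y) = act A x - act A y := map_sub _ _ _

theorem norm_act_le (A : Matrix (Fin n) (Fin n) ℝ) (x : Rn n) : ‖act A x‖ ≤ ‖A‖ * ‖x‖ :=
  (Matrix.toEuclideanCLM (𝕜 := ℝ) A).le_opNorm x

theorem inner_act_left (A : Matrix (Fin n) (Fin n) ℝ) (x y : Rn n) :
    inner ℝ (act A x) y = inner ℝ x (act A.transpose y) := by
  rw [act_eq_toEuclideanCLM, act_eq_toEuclideanCLM]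
  have : A.transpose = star A := by
    rw [Matrix.star_eq_conjTranspose, Matrix.conjTranspose_eq_transpose_of_trivial]
  rw [this, map_star, ContinuousLinearMap.star_eq_adjoint,
    ContinuousLinearMap.adjoint_inner_right]

theorem continuous_act : Continuous fun p : Matrix (Fin n) (Fin n) ℝ × Rn n => act p.1 p.2 := by
  have h : Continuous fun A : Matrix (Fin n) (Fin n) ℝ =>
      Matrix.toEuclideanCLM (𝕜 := ℝ) (n := Fin n) A := by
    exact LinearMap.continuous_of_finiteDimensional
      (Matrix.toEuclideanCLM (𝕜 := ℝ) (n := Fin n)).toAlgEquiv.toLinearMap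
  exact (h.comp continuous_fst).clm_apply continuous_snd

theorem _root_.Matrix.norm_transpose_real {ι : Type*} [Fintype ι] [DecidableEq ι]
    (A : Matrix ι ι ℝ) : ‖A.transpose‖ = ‖A‖ := by
  rw [← Matrix.conjTranspose_eq_transpose_of_trivial, Matrix.l2_opNorm_conjTranspose]

theorem posDef_of_inner_pos {A : Matrix (Fin n) (Fin n) ℝ} (hA : A.transpose = A)
    (h : ∀ x : Rn n, x ≠ 0 → 0 < inner ℝ (act A x) x) : A.PosDef := by
  refine Matrix.PosDef.of_dotProduct_mulVec_pos ?_ fun x hx => ?_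
  · rw [Matrix.IsHermitian, Matrix.conjTranspose_eq_transpose_of_trivial, hA]
  · have := h (WithLp.toLp 2 x) (by simpa using hx)
    rw [real_inner_comm, act_eq_toEuclideanCLM, Matrix.inner_toEuclideanCLM] at this
    simpa using this

theorem _root_.Matrix.PosDef.inner_act_pos {A : Matrix (Fin n) (Fin n) ℝ} (hA : A.PosDef)
    {x : Rn n} (hx : x ≠ 0) : 0 < inner ℝ (act A x) x := by
  have := hA.dotProduct_mulVec_pos (x := x.ofLp) (by simpa using hx)
  rw [real_inner_comm, act_eq_toEuclideanCLM, Matrix.inner_toEuclideanCLM]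
  simpa using this

theorem _root_.Matrix.PosDef.exists_inner_act_ge {A : Matrix (Fin n) (Fin n) ℝ} (hA : A.PosDef) :
    ∃ c : ℝ, 0 < c ∧ ∀ x : Rn n, c * ‖x‖ ^ 2 ≤ inner ℝ (act A x) x := by
  have hcont : Continuous fun x : Rn n => inner ℝ (act A x) x :=
    (continuous_act.comp (continuous_const.prodMk continuous_id)).inner continuous_id
  -- The sphere is empty when n = 0, which is not excluded here.
  rcases (Metric.sphere (0 : Rn n) 1).eq_empty_or_nonempty with h | h
  · refine ⟨1, one_pos, fun x => ?_⟩
    have : x = 0 := by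
      by_contra hx
      have : (‖x‖⁻¹ • x) ∈ Metric.sphere (0 : Rn n) 1 := by
        simp [norm_smul, hx]
      simp [h] at this
    subst this
    simp
  · obtain ⟨y, hy, hmin⟩ := (isCompact_sphere (0 : Rn n) 1).exists_isMinOn h hcont.continuousOn
    have hy0 : y ≠ 0 := by
      rintro rfl
      simp at hy
    refine ⟨_, hA.inner_act_pos hy0, fun x => ?_⟩
    by_cases hx : x = 0
    · subst hx; simp
    have hx' : (‖x‖⁻¹ • x) ∈ Metric.sphere (0 : Rn n) 1 := by simp [norm_smul, hx]
    have h1 := hmin hx'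
    simp only [Set.mem_ofPred_eq] at h1
    have h2 : act A (‖x‖⁻¹ • x) = ‖x‖⁻¹ • act A x := map_smul _ _ _
    rw [h2, inner_smul_left, inner_smul_right] at h1
    have hxp : 0 < ‖x‖ := norm_pos_iff.2 hx
    simp only [map_inv₀, conj_trivial] at h1
    calc _ ≤ (‖x‖⁻¹ * (‖x‖⁻¹ * inner ℝ (act A x) x)) * ‖x‖ ^ 2 := by gcongr
      _ = _ := by field_simp

/-- Testing the form on an orthonormal eigenbasis shows that every eigenvalue is at least c. -/
theorem _root_.Matrix.PosDef.pow_le_det {A : Matrix (Fin n) (Fin n) ℝ} (hA : A.PosDef) {c : ℝ}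
    (hc : 0 ≤ c) (h : ∀ x : Rn n, c * ‖x‖ ^ 2 ≤ inner ℝ (act A x) x) : c ^ n ≤ A.det := by
  rw [hA.isHermitian.det_eq_prod_eigenvalues]
  have : c ^ n = ∏ _i : Fin n, c := by simp
  rw [this]
  refine Finset.prod_le_prod (fun _ _ => hc) fun i _ => ?_
  have h1 := h (hA.isHermitian.eigenvectorBasis i)
  rw [real_inner_comm, act_eq_toEuclideanCLM, Matrix.inner_toEuclideanCLM] at h1
  rw [hA.isHermitian.mulVec_eigenvectorBasis, dotProduct_smul] at h1
  have h2 : (hA.isHermitian.eigenvectorBasis i).ofLp ⬝ᵥ (hA.isHermitian.eigenvectorBasis i).ofLp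
      = 1 := by
    have := (hA.isHermitian.eigenvectorBasis.orthonormal.1 i)
    have h3 : inner ℝ (hA.isHermitian.eigenvectorBasis i)
        (hA.isHermitian.eigenvectorBasis i) = (1 : ℝ) := by
      rw [real_inner_self_eq_norm_sq, this]; norm_num
    rw [EuclideanSpace.inner_eq_star_dotProduct] at h3
    simpa using h3
  rw [h2, hA.isHermitian.eigenvectorBasis.orthonormal.1 i] at h1
  simpa using h1

/-! ### The covariance matrices -/

theorem continuous_exp_smul (B : Matrix (Fin n) (Fin n) ℝ) :
    Continuous fun s : ℝ => NormedSpace.exp (s • B) :=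
  let _ : NormedAlgebra ℚ (Matrix (Fin n) (Fin n) ℝ) := NormedAlgebra.restrictScalars ℚ ℝ _
  NormedSpace.exp_continuous.comp (continuous_id.smul continuous_const)

theorem exp_add_smul (B : Matrix (Fin n) (Fin n) ℝ) (s t : ℝ) :
    NormedSpace.exp ((s + t) • B) = NormedSpace.exp (s • B) * NormedSpace.exp (t • B) := by
  rw [add_smul, Matrix.exp_add_of_commute]
  exact ((Commute.refl B).smul_left _).smul_right _

theorem exp_smul_mul_exp_neg_smul (B : Matrix (Fin n) (Fin n) ℝ) (s : ℝ) :
    NormedSpace.exp (s • B) * NormedSpace.exp ((-s) • B) = 1 := by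
  rw [← exp_add_smul]; simp

theorem exp_neg_smul_mul_exp_smul (B : Matrix (Fin n) (Fin n) ℝ) (s : ℝ) :
    NormedSpace.exp ((-s) • B) * NormedSpace.exp (s • B) = 1 := by
  rw [← exp_add_smul]; simp

theorem transpose_exp_smul (B : Matrix (Fin n) (Fin n) ℝ) (s : ℝ) :
    (NormedSpace.exp (s • B)).transpose = NormedSpace.exp (s • B.transpose) := by
  rw [← Matrix.exp_transpose, Matrix.transpose_smul]

theorem norm_exp_smul_transpose (B : Matrix (Fin n) (Fin n) ℝ) (s : ℝ) :
    ‖NormedSpace.exp (s • B.transpose)‖ = ‖NormedSpace.exp (s • B)‖ := by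
  rw [← transpose_exp_smul, Matrix.norm_transpose_real]

theorem continuous_covIntegrand (Q B : Matrix (Fin n) (Fin n) ℝ) :
    Continuous (covIntegrand Q B) :=
  ((continuous_exp_smul B).mul continuous_const).mul (continuous_exp_smul B.transpose)

theorem covIntegrand_add (Q B : Matrix (Fin n) (Fin n) ℝ) (s t : ℝ) :
    covIntegrand Q B (s + t) =
      NormedSpace.exp (t • B) * covIntegrand Q B s * NormedSpace.exp (t • B.transpose) := by
  rw [covIntegrand, covIntegrand, add_comm s t, exp_add_smul, add_comm t s, exp_add_smul]
  simp only [mul_assoc]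

theorem transpose_covIntegrand {Q : Matrix (Fin n) (Fin n) ℝ} (hQ : Q.transpose = Q)
    (B : Matrix (Fin n) (Fin n) ℝ) (s : ℝ) :
    (covIntegrand Q B s).transpose = covIntegrand Q B s := by
  rw [covIntegrand, Matrix.transpose_mul, Matrix.transpose_mul, transpose_exp_smul,
    transpose_exp_smul, Matrix.transpose_transpose, hQ, mul_assoc]

/-- The pairing `A ↦ ⟨A x, y⟩` as a continuous linear functional. -/
def pairingCLM (x y : Rn n) : Matrix (Fin n) (Fin n) ℝ →L[ℝ] ℝ :=
  LinearMap.toContinuousLinearMap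
    { toFun := fun A => inner ℝ (act A x) y
      map_add' := fun A A' => by rw [act_add_matrix, inner_add_left]
      map_smul' := fun c A => by
        have : act (c • A) x = c • act A x := by simp [act_eq_toEuclideanCLM]
        rw [this, inner_smul_left]; rfl }

theorem pairingCLM_apply (x y : Rn n) (A : Matrix (Fin n) (Fin n) ℝ) :
    pairingCLM x y A = inner ℝ (act A x) y := rfl

/-- Evaluation of an entry as a continuous linear functional. -/
def entryCLM (i j : Fin n) : Matrix (Fin n) (Fin n) ℝ →L[ℝ] ℝ :=
  LinearMap.toContinuousLinearMap (Matrix.entryLinearMap ℝ ℝ i j)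

theorem covT_eq_integral (Q B : Matrix (Fin n) (Fin n) ℝ) (t : ℝ) :
    covT Q B t = ∫ s in (0 : ℝ)..t, covIntegrand Q B s := by
  ext i j
  exact (entryCLM i j).intervalIntegral_comp_comm
    ((continuous_covIntegrand Q B).intervalIntegrable _ _)

theorem covInf_eq_integral {Q B : Matrix (Fin n) (Fin n) ℝ}
    (h : IntegrableOn (covIntegrand Q B) (Set.Ioi 0)) :
    covInf Q B = ∫ s in Set.Ioi (0 : ℝ), covIntegrand Q B s := by
  ext i j
  exact (entryCLM i j).integral_comp_comm h

theorem transpose_covT {Q : Matrix (Fin n) (Fin n) ℝ} (hQ : Q.transpose = Q)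
    (B : Matrix (Fin n) (Fin n) ℝ) (t : ℝ) : (covT Q B t).transpose = covT Q B t := by
  ext i j
  simp only [Matrix.transpose_apply, covT, Matrix.of_apply]
  congr 1
  ext s
  exact congrFun (congrFun (transpose_covIntegrand hQ B s) i) j

theorem transpose_covInf {Q : Matrix (Fin n) (Fin n) ℝ} (hQ : Q.transpose = Q)
    (B : Matrix (Fin n) (Fin n) ℝ) : (covInf Q B).transpose = covInf Q B := by
  ext i j
  simp only [Matrix.transpose_apply, covInf, Matrix.of_apply]
  congr 1
  ext s
  exact congrFun (congrFun (transpose_covIntegrand hQ B s) i) j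

theorem inner_covIntegrand (Q B : Matrix (Fin n) (Fin n) ℝ) (s : ℝ) (y : Rn n) :
    inner ℝ (act (covIntegrand Q B s) y) y =
      inner ℝ (act Q (act (NormedSpace.exp (s • B.transpose)) y))
        (act (NormedSpace.exp (s • B.transpose)) y) := by
  rw [covIntegrand, act_mul, act_mul, inner_act_left, transpose_exp_smul]

theorem continuous_inner_covIntegrand (Q B : Matrix (Fin n) (Fin n) ℝ) (y : Rn n) :
    Continuous fun s => inner ℝ (act (covIntegrand Q B s) y) y :=
  (pairingCLM y y).continuous.comp (continuous_covIntegrand Q B)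

theorem inner_covT (Q B : Matrix (Fin n) (Fin n) ℝ) (t : ℝ) (y : Rn n) :
    inner ℝ (act (covT Q B t) y) y =
      ∫ s in (0 : ℝ)..t, inner ℝ (act (covIntegrand Q B s) y) y := by
  rw [covT_eq_integral]
  exact ((pairingCLM y y).intervalIntegral_comp_comm
    ((continuous_covIntegrand Q B).intervalIntegrable _ _)).symm

theorem inner_covT_ge {Q B : Matrix (Fin n) (Fin n) ℝ} {q m t : ℝ} {y : Rn n} (ht : 0 ≤ t)
    (hq : 0 ≤ q) (hm : 0 ≤ m) (hQ : ∀ x : Rn n, q * ‖x‖ ^ 2 ≤ inner ℝ (act Q x) x)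
    (hy : ∀ s ∈ Set.Icc 0 t, m ≤ ‖act (NormedSpace.exp (s • B.transpose)) y‖) :
    q * m ^ 2 * t ≤ inner ℝ (act (covT Q B t) y) y := by
  rw [inner_covT]
  calc q * m ^ 2 * t = ∫ _s in (0 : ℝ)..t, q * m ^ 2 := by simp; ring
    _ ≤ _ := by
      refine intervalIntegral.integral_mono_on ht intervalIntegrable_const
        ((continuous_inner_covIntegrand Q B y).intervalIntegrable _ _) fun s hs => ?_
      rw [inner_covIntegrand]
      refine le_trans ?_ (hQ _)
      have := hy s hs
      gcongr

theorem inner_covT_mono {Q B : Matrix (Fin n) (Fin n) ℝ}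
    (hQ : ∀ x : Rn n, 0 ≤ inner ℝ (act Q x) x) {s t : ℝ} (hs : 0 ≤ s) (hst : s ≤ t) (y : Rn n) :
    inner ℝ (act (covT Q B s) y) y ≤ inner ℝ (act (covT Q B t) y) y := by
  rw [inner_covT, inner_covT]
  refine intervalIntegral.integral_mono_interval le_rfl hs hst ?_
    ((continuous_inner_covIntegrand Q B y).intervalIntegrable _ _)
  refine Filter.Eventually.of_forall fun r => ?_
  change 0 ≤ inner ℝ (act (covIntegrand Q B r) y) y
  rw [inner_covIntegrand]
  exact hQ _

theorem norm_covT_le {Q B : Matrix (Fin n) (Fin n) ℝ} {C t : ℝ} (ht : 0 ≤ t)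
    (hC : ∀ s ∈ Set.Icc 0 t, ‖covIntegrand Q B s‖ ≤ C) : ‖covT Q B t‖ ≤ C * t := by
  rw [covT_eq_integral]
  have := intervalIntegral.norm_integral_le_of_norm_le_const (a := 0) (b := t) (C := C)
    (f := covIntegrand Q B) (by
      intro s hs
      rw [Set.uIoc_of_le ht] at hs
      exact hC s ⟨hs.1.le, hs.2⟩)
  simpa [abs_of_nonneg ht] using this

theorem norm_covIntegrand_le (Q B : Matrix (Fin n) (Fin n) ℝ) (s : ℝ) :
    ‖covIntegrand Q B s‖ ≤ ‖NormedSpace.exp (s • B)‖ ^ 2 * ‖Q‖ := by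
  rw [covIntegrand]
  calc _ ≤ ‖NormedSpace.exp (s • B)‖ * ‖Q‖ * ‖NormedSpace.exp (s • B.transpose)‖ :=
        (norm_mul_le _ _).trans (by gcongr; exact norm_mul_le _ _)
    _ = _ := by rw [norm_exp_smul_transpose]; ring

theorem integrableOn_covIntegrand (Q : Matrix (Fin n) (Fin n) ℝ) {B : Matrix (Fin n) (Fin n) ℝ}
    {M δ : ℝ} (hδ : 0 < δ)
    (hB : ∀ t : ℝ, 0 ≤ t → ‖NormedSpace.exp (t • B)‖ ≤ M * Real.exp (-δ * t)) :
    IntegrableOn (covIntegrand Q B) (Set.Ioi 0) := by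
  have h1 : IntegrableOn (fun s : ℝ => M ^ 2 * ‖Q‖ * Real.exp (-(2 * δ) * s)) (Set.Ioi 0) :=
    (exp_neg_integrableOn_Ioi 0 (by positivity)).const_mul _
  refine Integrable.mono' h1 (continuous_covIntegrand Q B).aestronglyMeasurable ?_
  filter_upwards [ae_restrict_mem measurableSet_Ioi] with s hs
  refine (norm_covIntegrand_le Q B s).trans ?_
  calc _ ≤ (M * Real.exp (-δ * s)) ^ 2 * ‖Q‖ := by
        gcongr; exact hB s (le_of_lt hs)
    _ = _ := by
      rw [mul_pow, ← Real.exp_nat_mul]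
      push_cast
      ring_nf

/-- The tail of the integral beyond t is a conjugate of the whole integral, by the shift s ↦ s + t.
All identities relating Q_t, Q_∞ and D_t rest on this. -/
theorem covInf_eq_add {Q B : Matrix (Fin n) (Fin n) ℝ}
    (h : IntegrableOn (covIntegrand Q B) (Set.Ioi 0)) {t : ℝ} (ht : 0 ≤ t) :
    covInf Q B = covT Q B t +
      NormedSpace.exp (t • B) * covInf Q B * NormedSpace.exp (t • B.transpose) := by
  have h1 : IntegrableOn (covIntegrand Q B) (Set.Ioi t) :=
    h.mono_set (Set.Ioi_subset_Ioi ht)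
  have h2 := (measurePreserving_add_right volume t).setIntegral_preimage_emb
    (measurableEmbedding_addRight t) (covIntegrand Q B) (Set.Ioi t)
  rw [Set.preimage_add_const_Ioi, sub_self] at h2
  simp_rw [covIntegrand_add] at h2
  rw [integral_mul_const_of_integrable (h.const_mul _), integral_const_mul_of_integrable h,
    ← covInf_eq_integral h] at h2
  rw [h2, covT_eq_integral, intervalIntegral.integral_of_le ht, covInf_eq_integral h,
    ← setIntegral_union (Set.Ioc_disjoint_Ioi le_rfl) measurableSet_Ioi
      (h.mono_set Set.Ioc_subset_Ioi_self) h1, Set.Ioc_union_Ioi_eq_Ioi ht]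

theorem inner_covInf_nonneg {Q B : Matrix (Fin n) (Fin n) ℝ}
    (h : IntegrableOn (covIntegrand Q B) (Set.Ioi 0))
    (hQ : ∀ x : Rn n, 0 ≤ inner ℝ (act Q x) x) (y : Rn n) :
    0 ≤ inner ℝ (act (covInf Q B) y) y := by
  rw [covInf_eq_integral h]
  have := (pairingCLM y y).integral_comp_comm h
  rw [← pairingCLM_apply, ← this]
  refine integral_nonneg fun s => ?_
  change 0 ≤ inner ℝ (act (covIntegrand Q B s) y) y
  rw [inner_covIntegrand]
  exact hQ _

/-- `e^{tB}` decays exponentially as `t → ∞`. -/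
def ExpStable (B : Matrix (Fin n) (Fin n) ℝ) : Prop :=
  ∃ M δ : ℝ, 0 < δ ∧ ∀ t : ℝ, 0 ≤ t → ‖NormedSpace.exp (t • B)‖ ≤ M * Real.exp (-δ * t)

variable {Q B : Matrix (Fin n) (Fin n) ℝ}

theorem ExpStable.integrableOn (hB : ExpStable B) (Q : Matrix (Fin n) (Fin n) ℝ) :
    IntegrableOn (covIntegrand Q B) (Set.Ioi 0) := by
  obtain ⟨M, δ, hδ, h⟩ := hB
  exact integrableOn_covIntegrand Q hδ h

/-- The interval starts at -1 so that D_t, which contains e^{-tB*}, is bounded for all t ≤ 1. -/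
theorem ExpStable.exists_norm_exp_le (hB : ExpStable B) :
    ∃ M : ℝ, 0 < M ∧ ∀ t : ℝ, -1 ≤ t → ‖NormedSpace.exp (t • B)‖ ≤ M := by
  obtain ⟨M, δ, hδ, h⟩ := hB
  obtain ⟨S, hS⟩ := (isCompact_Icc (a := (-1 : ℝ)) (b := 0)).bddAbove_image
    (continuous_exp_smul B).norm.continuousOn
  refine ⟨max (max M S) 1, by positivity, fun t ht => ?_⟩
  rcases le_total 0 t with h0 | h0
  · have hM : 0 ≤ M := by simpa using (norm_nonneg _).trans (h 0 le_rfl)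
    refine (h t h0).trans (le_trans ?_ ((le_max_left _ _).trans (le_max_left _ _)))
    exact mul_le_of_le_one_right hM (Real.exp_le_one_iff.2 (by nlinarith))
  · exact (hS (Set.mem_image_of_mem _ ⟨ht, h0⟩)).trans
      ((le_max_right _ _).trans (le_max_left _ _))

theorem norm_le_norm_exp_mul (B : Matrix (Fin n) (Fin n) ℝ) {M s : ℝ}
    (h : ‖NormedSpace.exp ((-s) • B)‖ ≤ M) (y : Rn n) :
    ‖y‖ ≤ M * ‖act (NormedSpace.exp (s • B)) y‖ := by
  calc ‖y‖ = ‖act (NormedSpace.exp ((-s) • B)) (act (NormedSpace.exp (s • B)) y)‖ := by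
        rw [← act_mul, exp_neg_smul_mul_exp_smul, act_one]
    _ ≤ _ := (norm_act_le _ _).trans (by gcongr)

theorem _root_.Matrix.PosDef.transpose_eq (hQ : Q.PosDef) : Q.transpose = Q := by
  have := hQ.isHermitian
  rwa [Matrix.IsHermitian, Matrix.conjTranspose_eq_transpose_of_trivial] at this

theorem _root_.Matrix.PosDef.inner_act_nonneg (hQ : Q.PosDef) (x : Rn n) :
    0 ≤ inner ℝ (act Q x) x := by
  obtain ⟨c, hc, h⟩ := hQ.exists_inner_act_ge
  exact le_trans (by positivity) (h x)

theorem exists_inner_covT_ge (hQ : Q.PosDef) (B : Matrix (Fin n) (Fin n) ℝ) :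
    ∃ c : ℝ, 0 < c ∧ ∀ t : ℝ, 0 ≤ t → ∀ y : Rn n,
      c * min 1 t * ‖y‖ ^ 2 ≤ inner ℝ (act (covT Q B t) y) y := by
  obtain ⟨q, hq, hQq⟩ := hQ.exists_inner_act_ge
  obtain ⟨S, hS⟩ := (isCompact_Icc (a := (0 : ℝ)) (b := 1)).bddAbove_image
    ((continuous_exp_smul B.transpose).comp continuous_neg).norm.continuousOn
  set M := max S 1
  have hM : 0 < M := lt_of_lt_of_le one_pos (le_max_right _ _)
  have hle : ∀ t ∈ Set.Icc (0 : ℝ) 1, ∀ y : Rn n,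
      q * (M⁻¹ * ‖y‖) ^ 2 * t ≤ inner ℝ (act (covT Q B t) y) y := by
    intro t ht y
    refine inner_covT_ge ht.1 hq.le (by positivity) hQq fun s hs => ?_
    rw [inv_mul_le_iff₀ hM]
    refine norm_le_norm_exp_mul _ (le_trans ?_ (le_max_left _ _)) y
    exact hS (Set.mem_image_of_mem _ ⟨hs.1, hs.2.trans ht.2⟩)
  refine ⟨q * M⁻¹ ^ 2, by positivity, fun t ht y => ?_⟩
  rcases le_total t 1 with h1 | h1
  · rw [min_eq_right h1]
    refine le_trans (le_of_eq ?_) (hle t ⟨ht, h1⟩ y)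
    ring
  · rw [min_eq_left h1]
    refine le_trans (le_trans (le_of_eq ?_) (hle 1 ⟨zero_le_one, le_rfl⟩ y))
      (inner_covT_mono hQ.inner_act_nonneg zero_le_one h1 y)
    ring

/-- The integrand involves e^{(s-t)B*}y with s ≤ t, whose norm is at least a constant times |y|.
This makes R grow at least linearly in t along D_t, without saturation at large t. -/
theorem exists_inner_covT_exp_ge (hQ : Q.PosDef) (hB : ExpStable B) :
    ∃ c : ℝ, 0 < c ∧ ∀ t : ℝ, 0 ≤ t → ∀ y : Rn n,
      c * t * ‖y‖ ^ 2 ≤ inner ℝ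
        (act (covT Q B t) (act (NormedSpace.exp ((-t) • B.transpose)) y))
        (act (NormedSpace.exp ((-t) • B.transpose)) y) := by
  obtain ⟨q, hq, hQq⟩ := hQ.exists_inner_act_ge
  obtain ⟨M, hM, hBM⟩ := hB.exists_norm_exp_le
  refine ⟨q * M⁻¹ ^ 2, by positivity, fun t ht y => ?_⟩
  have := inner_covT_ge (Q := Q) (B := B) (m := M⁻¹ * ‖y‖)
    (y := act (NormedSpace.exp ((-t) • B.transpose)) y) ht hq.le (by positivity) hQq
    (fun s hs => by
      rw [inv_mul_le_iff₀ hM, ← act_mul, ← exp_add_smul]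
      refine norm_le_norm_exp_mul _ ?_ y
      rw [norm_exp_smul_transpose]
      exact hBM _ (by linarith [hs.2]))
  refine le_trans (le_of_eq ?_) this
  ring

theorem exists_norm_covT_le (Q B : Matrix (Fin n) (Fin n) ℝ) :
    ∃ C : ℝ, 0 < C ∧ ∀ t ∈ Set.Icc (0 : ℝ) 1, ‖covT Q B t‖ ≤ C * t := by
  obtain ⟨S, hS⟩ := (isCompact_Icc (a := (0 : ℝ)) (b := 1)).bddAbove_image
    (continuous_covIntegrand Q B).norm.continuousOn
  refine ⟨max S 1, by positivity, fun t ht => norm_covT_le ht.1 fun s hs => ?_⟩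
  exact (hS (Set.mem_image_of_mem _ ⟨hs.1, hs.2.trans ht.2⟩)).trans (le_max_left _ _)

theorem posDef_covT (hQ : Q.PosDef) (B : Matrix (Fin n) (Fin n) ℝ) {t : ℝ} (ht : 0 < t) :
    (covT Q B t).PosDef := by
  obtain ⟨c, hc, h⟩ := exists_inner_covT_ge hQ B
  refine posDef_of_inner_pos (transpose_covT hQ.transpose_eq B t) fun x hx => ?_
  refine lt_of_lt_of_le ?_ (h t ht.le x)
  have := norm_pos_iff.2 hx
  positivity

theorem posDef_covInf (hQ : Q.PosDef) (hB : ExpStable B) : (covInf Q B).PosDef := by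
  refine posDef_of_inner_pos (transpose_covInf hQ.transpose_eq B) fun x hx => ?_
  rw [covInf_eq_add (hB.integrableOn Q) zero_le_one, act_add_matrix, inner_add_left]
  refine add_pos_of_pos_of_nonneg ((posDef_covT hQ B one_pos).inner_act_pos hx) ?_
  rw [act_mul, act_mul, inner_act_left, transpose_exp_smul]
  exact inner_covInf_nonneg (hB.integrableOn Q) hQ.inner_act_nonneg _

theorem _root_.Matrix.PosDef.inv_mul (hQ : Q.PosDef) : Q⁻¹ * Q = 1 :=
  Matrix.nonsing_inv_mul _ hQ.det_pos.ne'.isUnit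

theorem _root_.Matrix.PosDef.mul_inv (hQ : Q.PosDef) : Q * Q⁻¹ = 1 :=
  Matrix.mul_nonsing_inv _ hQ.det_pos.ne'.isUnit

/-! ### The group D_t and the quadratic form R. -/

theorem matD_zero (hS : (covInf Q B).PosDef) : matD Q B 0 = 1 := by
  simp [matD, hS.mul_inv]

theorem matD_add (hS : (covInf Q B).PosDef) (s t : ℝ) :
    matD Q B (s + t) = matD Q B s * matD Q B t := by
  rw [matD, matD, matD, neg_add, exp_add_smul]
  calc _ = covInf Q B * NormedSpace.exp (-s • B.transpose) * 1 *
        NormedSpace.exp (-t • B.transpose) * (covInf Q B)⁻¹ := by simp only [mul_assoc, mul_one]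
    _ = _ := by rw [← hS.inv_mul]; simp only [mul_assoc]

theorem quadR_eq (hS : (covInf Q B).PosDef) (x : Rn n) :
    quadR Q B x = (1 / 2 : ℝ) * inner ℝ (act (covInf Q B) (act (covInf Q B)⁻¹ x))
      (act (covInf Q B)⁻¹ x) := by
  rw [quadR, ← act_mul, hS.mul_inv, act_one, real_inner_comm]

theorem quadR_matD (hQ : Q.PosDef) (hB : ExpStable B) {t : ℝ} (ht : 0 ≤ t) (x : Rn n) :
    quadR Q B (act (matD Q B t) x) = quadR Q B x + (1 / 2 : ℝ) * inner ℝ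
      (act (covT Q B t) (act (NormedSpace.exp ((-t) • B.transpose)) (act (covInf Q B)⁻¹ x)))
        (act (NormedSpace.exp ((-t) • B.transpose)) (act (covInf Q B)⁻¹ x)) := by
  have hS := posDef_covInf hQ hB
  have h1 : act (covInf Q B)⁻¹ (act (matD Q B t) x) =
      act (NormedSpace.exp ((-t) • B.transpose)) (act (covInf Q B)⁻¹ x) := by
    rw [matD, act_mul, act_mul, ← act_mul, hS.inv_mul, act_one]
  rw [quadR_eq hS, quadR_eq hS x, h1]
  set y := act (covInf Q B)⁻¹ x
  have h2 : act (NormedSpace.exp (t • B.transpose))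
      (act (NormedSpace.exp ((-t) • B.transpose)) y) = y := by
    rw [← act_mul, exp_smul_mul_exp_neg_smul, act_one]
  nth_rewrite 1 [covInf_eq_add (hB.integrableOn Q) ht]
  rw [act_add_matrix, inner_add_left, act_mul, act_mul, inner_act_left (NormedSpace.exp (t • B)),
    transpose_exp_smul, h2]
  ring

/-- The exponent of the Mehler kernel as a sum of two nonnegative quadratic forms. -/
theorem inner_mehler_exponent (hQ : Q.PosDef) (hB : ExpStable B) {t : ℝ} (ht : 0 < t) (v : Rn n) :
    inner ℝ (act ((covT Q B t)⁻¹ - (covInf Q B)⁻¹) (act (matD Q B t) v)) (act (matD Q B t) v) =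
      inner ℝ (act (covInf Q B)⁻¹ v) v +
        inner ℝ (act (covT Q B t)⁻¹ (act (NormedSpace.exp (t • B)) v))
          (act (NormedSpace.exp (t • B)) v) := by
  have hS := posDef_covInf hQ hB
  have hT := posDef_covT hQ B ht
  set S := covInf Q B with hSdef
  set T := covT Q B t with hTdef
  set E := NormedSpace.exp (t • B) with hE
  set e := NormedSpace.exp ((-t) • B.transpose) with he
  have hET : NormedSpace.exp (t • B.transpose) * e = 1 := exp_smul_mul_exp_neg_smul _ _
  have hST : S = T + E * S * NormedSpace.exp (t • B.transpose) :=
    covInf_eq_add (hB.integrableOn Q) ht.le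
  have hD : matD Q B t = S * e * S⁻¹ := rfl
  have hD2 : S * e * S⁻¹ = T * e * S⁻¹ + E := by
    calc S * e * S⁻¹ = (T + E * S * NormedSpace.exp (t • B.transpose)) * e * S⁻¹ := by rw [← hST]
      _ = T * e * S⁻¹ + E * (S * ((NormedSpace.exp (t • B.transpose) * e) * S⁻¹)) := by
        simp only [add_mul, mul_assoc]
      _ = _ := by rw [hET, one_mul, hS.mul_inv, mul_one]
  -- By `hD2` the terms e S⁻¹ cancel, and only T⁻¹ E survives.
  have hkey : (T⁻¹ - S⁻¹) * (S * e * S⁻¹) = T⁻¹ * E := by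
    have h1 : S⁻¹ * (S * e * S⁻¹) = e * S⁻¹ := by
      rw [mul_assoc, ← mul_assoc, hS.inv_mul, one_mul]
    have h2 : T⁻¹ * (T * e * S⁻¹) = e * S⁻¹ := by
      rw [mul_assoc, ← mul_assoc, hT.inv_mul, one_mul]
    rw [sub_mul, h1, hD2, mul_add, h2]
    abel
  have hTs : T⁻¹.transpose = T⁻¹ := hT.inv.transpose_eq
  rw [hD, ← act_mul, hkey, hD2, act_add_matrix, inner_add_right, act_mul]
  congr 1
  rw [inner_act_left, hTs, mul_assoc, ← act_mul, ← mul_assoc, hT.inv_mul, one_mul,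
    real_inner_comm, act_mul, inner_act_left, he, transpose_exp_smul, Matrix.transpose_transpose,
    ← act_mul, hE, exp_neg_smul_mul_exp_smul, act_one]

/-! ### Size of the Mehler kernel. -/

/-- With z = A⁻¹y the left-hand form is ⟨Az, z⟩ ≥ ct|z|², and |y| ≤ Ct|z|. -/
theorem inner_inv_ge {A : Matrix (Fin n) (Fin n) ℝ} (hA : A.PosDef) {c C t : ℝ} (hc : 0 < c)
    (hC : 0 < C) (ht : 0 < t) (hlow : ∀ y : Rn n, c * t * ‖y‖ ^ 2 ≤ inner ℝ (act A y) y)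
    (hup : ‖A‖ ≤ C * t) (y : Rn n) :
    c / C ^ 2 * ‖y‖ ^ 2 / t ≤ inner ℝ (act A⁻¹ y) y := by
  have h1 : act A (act A⁻¹ y) = y := by rw [← act_mul, hA.mul_inv, act_one]
  have h2 := hlow (act A⁻¹ y)
  rw [h1, real_inner_comm] at h2
  refine le_trans ?_ h2
  have h3 : ‖y‖ ≤ C * t * ‖act A⁻¹ y‖ := by
    calc ‖y‖ = ‖act A (act A⁻¹ y)‖ := by rw [h1]
      _ ≤ ‖A‖ * ‖act A⁻¹ y‖ := norm_act_le _ _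
      _ ≤ _ := by gcongr
  calc c / C ^ 2 * ‖y‖ ^ 2 / t ≤ c / C ^ 2 * (C * t * ‖act A⁻¹ y‖) ^ 2 / t := by gcongr
    _ = _ := by field_simp

/-- Of the two forms in `inner_mehler_exponent`, the one with Q_t⁻¹ suffices for t ≤ 1 and the one
with Q_∞⁻¹ for t ≥ 1. -/
theorem exists_mehler_exponent_ge (hQ : Q.PosDef) (hB : ExpStable B) :
    ∃ c : ℝ, 0 < c ∧ ∀ t : ℝ, 0 < t → ∀ v : Rn n,
      c * ‖v‖ ^ 2 / min 1 t ≤ inner ℝ (act ((covT Q B t)⁻¹ - (covInf Q B)⁻¹)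
        (act (matD Q B t) v)) (act (matD Q B t) v) := by
  have hS := posDef_covInf hQ hB
  obtain ⟨a, ha, hSa⟩ := hS.inv.exists_inner_act_ge
  obtain ⟨c, hc, hlow⟩ := exists_inner_covT_ge hQ B
  obtain ⟨C, hC, hup⟩ := exists_norm_covT_le Q B
  obtain ⟨S, hS1⟩ := (isCompact_Icc (a := (0 : ℝ)) (b := 1)).bddAbove_image
    ((continuous_exp_smul B).comp continuous_neg).norm.continuousOn
  set M := max S 1
  have hM : 0 < M := lt_of_lt_of_le one_pos (le_max_right _ _)
  refine ⟨min a (c / C ^ 2 * M⁻¹ ^ 2), by positivity, fun t ht v => ?_⟩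
  rw [inner_mehler_exponent hQ hB ht]
  rcases le_total t 1 with h1 | h1
  · rw [min_eq_right h1]
    refine le_trans ?_ (le_add_of_nonneg_left (hS.inv.inner_act_nonneg v))
    have h2 : ∀ y : Rn n, c * t * ‖y‖ ^ 2 ≤ inner ℝ (act (covT Q B t) y) y := by
      intro y
      have := hlow t ht.le y
      rwa [min_eq_right h1] at this
    refine le_trans ?_ (inner_inv_ge (posDef_covT hQ B ht) hc hC ht h2 (hup t ⟨ht.le, h1⟩) _)
    have h3 : M⁻¹ * ‖v‖ ≤ ‖act (NormedSpace.exp (t • B)) v‖ := by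
      rw [inv_mul_le_iff₀ hM]
      exact norm_le_norm_exp_mul _ ((hS1 (Set.mem_image_of_mem _ ⟨ht.le, h1⟩)).trans
        (le_max_left _ _)) v
    calc _ ≤ (c / C ^ 2 * M⁻¹ ^ 2) * ‖v‖ ^ 2 / t := by gcongr; exact min_le_right _ _
      _ = c / C ^ 2 * (M⁻¹ * ‖v‖) ^ 2 / t := by ring
      _ ≤ _ := by gcongr
  · rw [min_eq_left h1, div_one]
    refine le_trans ?_ (le_add_of_nonneg_right ((posDef_covT hQ B ht).inv.inner_act_nonneg _))
    exact le_trans (by gcongr; exact min_le_left _ _) (hSa v)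

theorem exists_pow_mul_exp_neg_sq_le (n : ℕ) {c : ℝ} (hc : 0 < c) :
    ∃ C : ℝ, 0 < C ∧ ∀ s : ℝ, 0 ≤ s → s ^ n * Real.exp (-c * s ^ 2) ≤ C := by
  refine ⟨n.factorial * Real.exp (1 / (4 * c)), by positivity, fun s hs => ?_⟩
  have h1 : s ^ n ≤ n.factorial * Real.exp s := by
    have := Real.pow_div_factorial_le_exp s hs n
    rwa [div_le_iff₀ (by positivity), mul_comm] at this
  calc s ^ n * Real.exp (-c * s ^ 2) ≤ (n.factorial * Real.exp s) * Real.exp (-c * s ^ 2) := by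
        gcongr
    _ = n.factorial * Real.exp (s + -c * s ^ 2) := by rw [mul_assoc, ← Real.exp_add]
    _ ≤ _ := by
      gcongr
      rw [le_div_iff₀ (by positivity)]
      nlinarith [sq_nonneg (2 * c * s - 1)]

/-- The determinant factor costs min(1,t)^{-n/2}. The Gaussian in |v|/√min(1,t) is bounded, also
after multiplication by the n-th power of its argument, which trades min(1,t)^{n/2} for |v|^n. -/
theorem exists_mehlerKernel_le (hQ : Q.PosDef) (hB : ExpStable B) :
    ∃ C : ℝ, 0 < C ∧ ∀ t : ℝ, 0 < t → ∀ x u : Rn n,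
      mehlerKernel Q B t x u * √(min 1 t) ^ n ≤ C * Real.exp (quadR Q B x) ∧
      mehlerKernel Q B t x u * ‖act (matD Q B (-t)) u - x‖ ^ n ≤ C * Real.exp (quadR Q B x) := by
  have hS := posDef_covInf hQ hB
  obtain ⟨a, ha, hexp⟩ := exists_mehler_exponent_ge hQ hB
  obtain ⟨c, hc, hlow⟩ := exists_inner_covT_ge hQ B
  obtain ⟨C, hC, hpow⟩ := exists_pow_mul_exp_neg_sq_le n (half_pos ha)
  set d := ((covInf Q B).det / c ^ n) ^ (1 / 2 : ℝ) with hd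
  have hdetS := hS.det_pos
  have hd0 : 0 < d := by positivity
  refine ⟨d * (C + 1), by positivity, fun t ht x u => ?_⟩
  set v := act (matD Q B (-t)) u - x with hv
  set τ := min 1 t with hτ
  have hτ0 : 0 < τ := lt_min one_pos ht
  have hv1 : u - act (matD Q B t) x = act (matD Q B t) v := by
    rw [hv, act_sub, ← act_mul, ← matD_add hS]
    simp [matD_zero hS, act_one]
  have hdet : ((covInf Q B).det / (covT Q B t).det) ^ (1 / 2 : ℝ) * √τ ^ n ≤ d := by
    have h1 := (posDef_covT hQ B ht).pow_le_det (c := c * τ) (by positivity) (hlow t ht.le)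
    have h2 : (√τ ^ n) = (τ ^ n) ^ (1 / 2 : ℝ) := by
      rw [Real.sqrt_eq_rpow, ← Real.rpow_natCast, ← Real.rpow_mul hτ0.le, ← Real.rpow_natCast,
        ← Real.rpow_mul hτ0.le, mul_comm]
    have h3 := (posDef_covT hQ B ht).det_pos
    rw [h2, ← Real.mul_rpow (by positivity) (by positivity), hd]
    refine Real.rpow_le_rpow (by positivity) ?_ (by norm_num)
    rw [mul_pow] at h1
    rw [div_mul_eq_mul_div, div_le_div_iff₀ h3 (by positivity)]
    nlinarith
  have hK : mehlerKernel Q B t x u * √τ ^ n ≤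
      d * Real.exp (quadR Q B x) * Real.exp (-(a / 2) * (‖v‖ / √τ) ^ 2) := by
    rw [mehlerKernel, hv1]
    have h1 : Real.exp (-(1 / 2 : ℝ) * inner ℝ (act ((covT Q B t)⁻¹ - (covInf Q B)⁻¹)
        (act (matD Q B t) v)) (act (matD Q B t) v)) ≤ Real.exp (-(a / 2) * (‖v‖ / √τ) ^ 2) := by
      apply Real.exp_le_exp.2
      have := hexp t ht v
      rw [div_pow, Real.sq_sqrt hτ0.le]
      have h4 : a * ‖v‖ ^ 2 / τ = a * (‖v‖ ^ 2 / τ) := by ring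
      rw [h4] at this
      linarith
    rw [mul_right_comm, mul_right_comm _ (Real.exp (quadR Q B x))]
    gcongr
  constructor
  · refine hK.trans ?_
    have : Real.exp (-(a / 2) * (‖v‖ / √τ) ^ 2) ≤ 1 :=
      Real.exp_le_one_iff.2 (by have : 0 ≤ (‖v‖ / √τ) ^ 2 := by positivity
                                nlinarith)
    calc _ ≤ d * Real.exp (quadR Q B x) * (C + 1) := by gcongr; linarith
      _ = _ := by ring
  · have hs : 0 < √τ := Real.sqrt_pos.2 hτ0
    calc mehlerKernel Q B t x u * ‖v‖ ^ n
        = (mehlerKernel Q B t x u * √τ ^ n) * (‖v‖ / √τ) ^ n := by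
          rw [div_pow]; field_simp
      _ ≤ (d * Real.exp (quadR Q B x) * Real.exp (-(a / 2) * (‖v‖ / √τ) ^ 2)) *
          (‖v‖ / √τ) ^ n := by gcongr
      _ = d * Real.exp (quadR Q B x) * ((‖v‖ / √τ) ^ n * Real.exp (-(a / 2) * (‖v‖ / √τ) ^ 2)) := by
        ring
      _ ≤ d * Real.exp (quadR Q B x) * C := by
        gcongr; exact hpow _ (by positivity)
      _ ≤ d * Real.exp (quadR Q B x) * (C + 1) := by gcongr; linarith
      _ = _ := by ring

/-- A linear flow on `ℝⁿ` that expands a quadratically bounded function `form` at a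
quadratic rate, together with the constants quantifying this. -/
structure ExpandingFlow (n : ℕ) where
  flow : ℝ → Rn n → Rn n
  form : Rn n → ℝ
  /-- upper bound for all quantities bounded above -/
  M : ℝ
  /-- lower bound for all quantities bounded below -/
  κ : ℝ
  M_pos : 0 < M
  κ_pos : 0 < κ
  flow_zero : ∀ x, flow 0 x = x
  flow_add : ∀ s t x, flow (s + t) x = flow s (flow t x)
  flow_sub : ∀ t x y, flow t (x - y) = flow t x - flow t y
  continuous_flow : Continuous fun p : ℝ × Rn n => flow p.1 p.2
  continuous_form : Continuous form
  form_le : ∀ x, form x ≤ M * ‖x‖ ^ 2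
  le_form : ∀ x, κ * ‖x‖ ^ 2 ≤ form x
  form_flow_ge : ∀ t, 0 ≤ t → ∀ x, form x + κ * t * ‖x‖ ^ 2 ≤ form (flow t x)
  -- All negative times are included: backwards in time the flow is uniformly bounded.
  norm_flow_le : ∀ t, t ≤ 1 → ∀ x, ‖flow t x‖ ≤ M * ‖x‖
  norm_flow_sub_le : ∀ t, |t| ≤ 1 → ∀ x, ‖flow t x - x‖ ≤ M * |t| * ‖x‖
  lintegral_le : ∀ s ∈ Set.Icc (0 : ℝ) 1, ∀ f : Rn n → ℝ≥0∞, Measurable f →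
    ∫⁻ x, f x ≤ ENNReal.ofReal M * ∫⁻ x, f (flow s x)

/-! ### D_t as an expanding flow. -/

theorem det_toEuclideanLin (A : Matrix (Fin n) (Fin n) ℝ) :
    LinearMap.det (Matrix.toEuclideanLin A) = A.det := by
  rw [Matrix.toEuclideanLin_eq_toLin_orthonormal, LinearMap.det_toLin]

theorem lintegral_eq_det_mul_lintegral_act {A : Matrix (Fin n) (Fin n) ℝ} (hA : A.det ≠ 0)
    {f : Rn n → ℝ≥0∞} (hf : Measurable f) :
    ∫⁻ x, f x = ENNReal.ofReal |A.det| * ∫⁻ x, f (act A x) := by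
  have hdet : LinearMap.det (Matrix.toEuclideanLin A) ≠ 0 := by rwa [det_toEuclideanLin]
  have hmeas : Measurable (act A) :=
    (continuous_act.comp (continuous_const.prodMk continuous_id)).measurable
  have h := Measure.map_linearMap_addHaar_eq_smul_addHaar (volume : Measure (Rn n)) hdet
  have h2 : ∫⁻ x, f (act A x) = ∫⁻ x, f x ∂(Measure.map (Matrix.toEuclideanLin A) volume) :=
    (lintegral_map hf hmeas).symm
  rw [h2, h, lintegral_smul_measure, det_toEuclideanLin, smul_eq_mul, ← mul_assoc,
    ← ENNReal.ofReal_mul (abs_nonneg _), abs_inv, mul_inv_cancel₀ (abs_ne_zero.2 hA)]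
  simp

theorem continuous_matD (Q B : Matrix (Fin n) (Fin n) ℝ) : Continuous (matD Q B) :=
  (continuous_const.mul ((continuous_exp_smul B.transpose).comp continuous_neg)).mul
    continuous_const

theorem exists_norm_matD_le (hB : ExpStable B) (Q : Matrix (Fin n) (Fin n) ℝ) :
    ∃ C : ℝ, 0 < C ∧ ∀ t : ℝ, t ≤ 1 → ‖matD Q B t‖ ≤ C := by
  obtain ⟨M, hM, h⟩ := hB.exists_norm_exp_le
  refine ⟨‖covInf Q B‖ * M * ‖(covInf Q B)⁻¹‖ + 1, by positivity, fun t ht => ?_⟩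
  have h1 : ‖NormedSpace.exp ((-t) • B.transpose)‖ ≤ M := by
    rw [norm_exp_smul_transpose]; exact h _ (by linarith)
  calc ‖matD Q B t‖ ≤ ‖covInf Q B‖ * ‖NormedSpace.exp ((-t) • B.transpose)‖ *
        ‖(covInf Q B)⁻¹‖ := (norm_mul_le _ _).trans (by gcongr; exact norm_mul_le _ _)
    _ ≤ ‖covInf Q B‖ * M * ‖(covInf Q B)⁻¹‖ := by gcongr
    _ ≤ _ := by linarith

theorem exists_norm_exp_smul_sub_one_le (A : Matrix (Fin n) (Fin n) ℝ) :
    ∃ C : ℝ, 0 ≤ C ∧ ∀ t : ℝ, |t| ≤ 1 → ‖NormedSpace.exp (t • A) - 1‖ ≤ C * |t| := by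
  obtain ⟨C, hC⟩ := (isCompact_Icc (a := (-1 : ℝ)) (b := 1)).bddAbove_image
    ((continuous_exp_smul A).mul continuous_const (f := fun s => NormedSpace.exp (s • A))
      (g := fun _ => A)).norm.continuousOn
  refine ⟨C, (norm_nonneg _).trans (hC (Set.mem_image_of_mem _ ⟨by norm_num, zero_le_one⟩ :
    _ ∈ _ '' Set.Icc (-1 : ℝ) 1)), fun t ht => ?_⟩
  have := (convex_Icc (-1 : ℝ) 1).norm_image_sub_le_of_norm_hasDerivWithin_le
    (f := fun s : ℝ => NormedSpace.exp (s • A)) (x := 0) (y := t) (C := C)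
    (fun s _ => (hasDerivAt_exp_smul_const (𝕂 := ℝ) A s).hasDerivWithinAt)
    (fun s hs => hC (Set.mem_image_of_mem _ hs)) ⟨by norm_num, zero_le_one⟩ (abs_le.1 ht)
  simpa using this

theorem exists_norm_matD_sub_one_le (hS : (covInf Q B).PosDef) :
    ∃ C : ℝ, 0 ≤ C ∧ ∀ t : ℝ, |t| ≤ 1 → ‖matD Q B t - 1‖ ≤ C * |t| := by
  obtain ⟨C, hC0, hC⟩ := exists_norm_exp_smul_sub_one_le B.transpose
  refine ⟨‖covInf Q B‖ * C * ‖(covInf Q B)⁻¹‖, by positivity, fun t ht => ?_⟩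
  have h1 : matD Q B t - 1 =
      covInf Q B * (NormedSpace.exp ((-t) • B.transpose) - 1) * (covInf Q B)⁻¹ := by
    rw [matD, mul_sub, sub_mul, mul_one, hS.mul_inv]
  rw [h1]
  calc _ ≤ ‖covInf Q B‖ * ‖NormedSpace.exp ((-t) • B.transpose) - 1‖ *
        ‖(covInf Q B)⁻¹‖ := (norm_mul_le _ _).trans (by gcongr; exact norm_mul_le _ _)
    _ ≤ ‖covInf Q B‖ * (C * |t|) * ‖(covInf Q B)⁻¹‖ := by
      gcongr
      simpa using hC (-t) (by simpa using ht)
    _ = _ := by ring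

theorem det_matD_ne_zero (hS : (covInf Q B).PosDef) (t : ℝ) : (matD Q B t).det ≠ 0 := by
  intro h
  have := congrArg Matrix.det (matD_add hS t (-t))
  rw [Matrix.det_mul, h, add_neg_cancel, matD_zero hS] at this
  simp at this

theorem continuous_quadR (Q B : Matrix (Fin n) (Fin n) ℝ) : Continuous (quadR Q B) :=
  continuous_const.mul
    ((continuous_act.comp (continuous_const.prodMk continuous_id)).inner continuous_id)

theorem exists_expandingFlow (hQ : Q.PosDef) (hB : ExpStable B) :
    ∃ Φ : ExpandingFlow n, Φ.form = quadR Q B ∧ ∀ t x, Φ.flow t x = act (matD Q B t) x := by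
  have hS := posDef_covInf hQ hB
  obtain ⟨C1, hC1, hD⟩ := exists_norm_matD_le hB Q
  obtain ⟨C2, hC2, hDsub⟩ := exists_norm_matD_sub_one_le hS
  obtain ⟨C3, hC3⟩ := (isCompact_Icc (a := (0 : ℝ)) (b := 1)).bddAbove_image
    (continuous_matD Q B).matrix_det.abs.continuousOn
  obtain ⟨a, ha, hSa⟩ := hS.inv.exists_inner_act_ge
  obtain ⟨c, hc, hcov⟩ := exists_inner_covT_exp_ge hQ hB
  have hinv : ∀ x : Rn n, ‖x‖ ≤ (‖covInf Q B‖ + 1) * ‖act (covInf Q B)⁻¹ x‖ := by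
    intro x
    calc ‖x‖ = ‖act (covInf Q B) (act (covInf Q B)⁻¹ x)‖ := by
          rw [← act_mul, hS.mul_inv, act_one]
      _ ≤ ‖covInf Q B‖ * ‖act (covInf Q B)⁻¹ x‖ := norm_act_le _ _
      _ ≤ _ := by gcongr; linarith
  obtain ⟨b, hb0, hinv⟩ : ∃ b : ℝ, 0 < b ∧ ∀ x : Rn n, ‖x‖ ≤ b * ‖act (covInf Q B)⁻¹ x‖ :=
    ⟨_, by positivity, hinv⟩
  obtain ⟨M, hM1, hM2, hM3, hM4⟩ : ∃ M : ℝ, C1 ≤ M ∧ C2 ≤ M ∧ C3 ≤ M ∧ ‖(covInf Q B)⁻¹‖ ≤ M :=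
    ⟨max (max C1 C2) (max C3 (‖(covInf Q B)⁻¹‖)), by simp, by simp, by simp, by simp⟩
  obtain ⟨κ, hκ0, hκ1, hκ2⟩ : ∃ κ : ℝ, 0 < κ ∧ κ ≤ a / 2 ∧ κ ≤ c / (2 * b ^ 2) :=
    ⟨min (a / 2) (c / (2 * b ^ 2)), by positivity, min_le_left _ _, min_le_right _ _⟩
  have hM0 : 0 < M := hC1.trans_le hM1
  have hflow : Continuous fun p : ℝ × Rn n => act (matD Q B p.1) p.2 := by
    have h : Continuous fun p : ℝ × Rn n => matD Q B p.1 :=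
      (continuous_matD Q B).comp continuous_fst
    exact Continuous.comp (g := fun p : Matrix (Fin n) (Fin n) ℝ × Rn n => act p.1 p.2)
      (f := fun p : ℝ × Rn n => (matD Q B p.1, p.2)) continuous_act (h.prodMk continuous_snd)
  have hform_le : ∀ x : Rn n, quadR Q B x ≤ M * ‖x‖ ^ 2 := by
    intro x
    rw [quadR]
    have h1 := (real_inner_le_norm (act (covInf Q B)⁻¹ x) x)
    have h2 : ‖act (covInf Q B)⁻¹ x‖ * ‖x‖ ≤ M * ‖x‖ * ‖x‖ := by
      gcongr; exact (norm_act_le _ _).trans (by gcongr)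
    have h3 : 0 ≤ M * ‖x‖ * ‖x‖ := by positivity
    have h4 : M * ‖x‖ ^ 2 = M * ‖x‖ * ‖x‖ := by ring
    linarith
  have hle_form : ∀ x : Rn n, κ * ‖x‖ ^ 2 ≤ quadR Q B x := by
    intro x
    rw [quadR]
    have h1 := hSa x
    have h2 : κ * ‖x‖ ^ 2 ≤ a / 2 * ‖x‖ ^ 2 := by gcongr
    linarith
  have hgrowth : ∀ t, 0 ≤ t → ∀ x : Rn n,
      quadR Q B x + κ * t * ‖x‖ ^ 2 ≤ quadR Q B (act (matD Q B t) x) := by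
    intro t ht x
    rw [quadR_matD hQ hB ht]
    have h1 := hcov t ht (act (covInf Q B)⁻¹ x)
    have h2 : κ * t * ‖x‖ ^ 2 ≤ c / (2 * b ^ 2) * t * (b * ‖act (covInf Q B)⁻¹ x‖) ^ 2 := by
      gcongr
      exact hinv x
    have h3 : c / (2 * b ^ 2) * t * (b * ‖act (covInf Q B)⁻¹ x‖) ^ 2 =
        1 / 2 * (c * t * ‖act (covInf Q B)⁻¹ x‖ ^ 2) := by field_simp
    linarith
  have hnorm : ∀ t, t ≤ 1 → ∀ x : Rn n, ‖act (matD Q B t) x‖ ≤ M * ‖x‖ := fun t ht x =>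
    (norm_act_le _ _).trans (by gcongr; exact (hD t ht).trans hM1)
  have hsub : ∀ t, |t| ≤ 1 → ∀ x : Rn n, ‖act (matD Q B t) x - x‖ ≤ M * |t| * ‖x‖ := by
    intro t ht x
    have : act (matD Q B t) x - x = act (matD Q B t - 1) x := by
      rw [act_sub_matrix, act_one]
    rw [this]
    exact (norm_act_le _ _).trans (by gcongr; exact (hDsub t ht).trans (by gcongr))
  have hjac : ∀ s ∈ Set.Icc (0 : ℝ) 1, ∀ f : Rn n → ℝ≥0∞, Measurable f →
      ∫⁻ x, f x ≤ ENNReal.ofReal M * ∫⁻ x, f (act (matD Q B s) x) := by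
    intro s hs f hf
    rw [lintegral_eq_det_mul_lintegral_act (det_matD_ne_zero hS s) hf]
    gcongr
    exact (hC3 (Set.mem_image_of_mem _ hs)).trans hM3
  exact ⟨{  flow := fun t x => act (matD Q B t) x
            form := quadR Q B
            M := M
            κ := κ
            M_pos := hM0
            κ_pos := hκ0
            flow_zero := fun x => by rw [matD_zero hS, act_one]
            flow_add := fun s t x => by rw [matD_add hS, act_mul]
            flow_sub := fun t x y => act_sub _ _ _
            continuous_flow := hflow
            continuous_form := continuous_quadR Q B
            form_le := hform_le
            le_form := hle_form
            form_flow_ge := hgrowth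
            norm_flow_le := hnorm
            norm_flow_sub_le := hsub
            lintegral_le := hjac }, rfl, fun _ _ => rfl⟩

end OrnsteinUhlenbeck
end

noncomputable section

namespace OrnsteinUhlenbeck

open MeasureTheory

variable {n : ℕ}

/-! ### Two auxiliary integrals. -/

theorem lintegral_inv_one_add_norm_pow_lt_top (n : ℕ) :
    ∫⁻ x : Rn n, ENNReal.ofReal ((1 + ‖x‖)⁻¹ ^ (n + 1)) < ⊤ := by
  have h : Integrable (fun x : Rn n => (1 + ‖x‖) ^ (-((n : ℝ) + 1))) :=
    integrable_one_add_norm (by simp)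
  have h2 := h.lintegral_lt_top
  refine lt_of_eq_of_lt (lintegral_congr fun x => ?_) h2
  congr 1
  have hx : (0 : ℝ) ≤ 1 + ‖x‖ := by positivity
  rw [Real.rpow_neg hx, inv_pow]
  congr 1
  exact_mod_cast (Real.rpow_natCast (1 + ‖x‖) (n + 1)).symm

theorem lintegral_inv_add_norm_sub_pow {b : ℝ} (hb : 0 < b) (w : Rn n) :
    ∫⁻ x : Rn n, ENNReal.ofReal ((b + ‖w - x‖)⁻¹ ^ (n + 1)) =
      ENNReal.ofReal b⁻¹ * ∫⁻ x : Rn n, ENNReal.ofReal ((1 + ‖x‖)⁻¹ ^ (n + 1)) := by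
  have h1 : ∫⁻ x : Rn n, ENNReal.ofReal ((b + ‖w - x‖)⁻¹ ^ (n + 1)) =
      ∫⁻ x : Rn n, ENNReal.ofReal ((b + ‖x‖)⁻¹ ^ (n + 1)) :=
    lintegral_sub_left_eq_self (fun x : Rn n => ENNReal.ofReal ((b + ‖x‖)⁻¹ ^ (n + 1))) w
  have hdet : (b • (1 : Matrix (Fin n) (Fin n) ℝ)).det = b ^ n := by
    rw [Matrix.det_smul]; simp
  have hact : ∀ x : Rn n, act (b • (1 : Matrix (Fin n) (Fin n) ℝ)) x = b • x := by
    intro x; simp [act_eq_toEuclideanCLM]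
  have hmeas : Measurable fun x : Rn n => ENNReal.ofReal ((b + ‖x‖)⁻¹ ^ (n + 1)) := by fun_prop
  rw [h1, lintegral_eq_det_mul_lintegral_act (A := b • 1) (by rw [hdet]; positivity) hmeas, hdet,
    abs_of_pos (by positivity), ← lintegral_const_mul' _ _ ENNReal.ofReal_ne_top,
    ← lintegral_const_mul' _ _ ENNReal.ofReal_ne_top]
  refine lintegral_congr fun x => ?_
  rw [hact, norm_smul, Real.norm_of_nonneg hb.le, ← ENNReal.ofReal_mul (by positivity),
    ← ENNReal.ofReal_mul (by positivity)]
  congr 1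
  have : b + b * ‖x‖ = b * (1 + ‖x‖) := by ring
  rw [this, mul_inv, mul_pow, pow_succ b⁻¹, ← mul_assoc, ← mul_assoc, ← mul_pow,
    mul_inv_cancel₀ hb.ne', one_pow, one_mul]

/-- S need not be an interval: comparison with its infimum s₀ gives φ(s) ≥ a + k(s - s₀), after
which the integral is at most that of an exponential on (s₀, ∞). -/
theorem lintegral_exp_neg_le_of_growth {φ : ℝ → ℝ} {S : Set ℝ} {a k : ℝ} (hS : MeasurableSet S)
    (hbdd : BddBelow S) (hk : 0 < k) (ha : ∀ s ∈ S, a ≤ φ s)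
    (hφ : ∀ s ∈ S, ∀ s' ∈ S, s ≤ s' → φ s + k * (s' - s) ≤ φ s') :
    ∫⁻ s in S, ENNReal.ofReal (Real.exp (-φ s)) ≤ ENNReal.ofReal (Real.exp (-a) / k) := by
  rcases S.eq_empty_or_nonempty with rfl | hne
  · simp
  set s₀ := sInf S with hs₀
  have hlow : ∀ s ∈ S, a + k * (s - s₀) ≤ φ s := by
    intro s hs
    have h1 : s - (φ s - a) / k ≤ s₀ := by
      refine le_csInf hne fun s' hs' => ?_
      rcases le_total s' s with h | h
      · have h2 := hφ s' hs' s hs h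
        have h3 := ha s' hs'
        have : s - s' ≤ (φ s - a) / k := by
          rw [le_div_iff₀ hk]; linarith
        linarith
      · have : 0 ≤ (φ s - a) / k := div_nonneg (by linarith [ha s hs]) hk.le
        linarith
    have h4 : s - s₀ ≤ (φ s - a) / k := by linarith
    rw [le_div_iff₀ hk] at h4
    linarith
  have hsub : S ⊆ Set.Ici s₀ := fun s hs => csInf_le hbdd hs
  have hint : IntegrableOn (fun s => Real.exp (-a + k * s₀) * Real.exp (-k * s)) (Set.Ioi s₀) :=
    (exp_neg_integrableOn_Ioi s₀ hk).const_mul _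
  calc ∫⁻ s in S, ENNReal.ofReal (Real.exp (-φ s))
      ≤ ∫⁻ s in S, ENNReal.ofReal (Real.exp (-a + k * s₀) * Real.exp (-k * s)) := by
        refine setLIntegral_mono' hS fun s hs => ?_
        rw [← Real.exp_add]
        refine ENNReal.ofReal_le_ofReal (Real.exp_le_exp.2 ?_)
        linarith [hlow s hs]
    _ ≤ ∫⁻ s in Set.Ici s₀, ENNReal.ofReal (Real.exp (-a + k * s₀) * Real.exp (-k * s)) :=
        lintegral_mono_set hsub
    _ = ∫⁻ s in Set.Ioi s₀, ENNReal.ofReal (Real.exp (-a + k * s₀) * Real.exp (-k * s)) :=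
        setLIntegral_congr Ioi_ae_eq_Ici.symm
    _ = ENNReal.ofReal (∫ s in Set.Ioi s₀, Real.exp (-a + k * s₀) * Real.exp (-k * s)) := by
        rw [ofReal_integral_eq_lintegral_ofReal hint]
        exact Filter.Eventually.of_forall fun s => by positivity
    _ = _ := by
        congr 1
        rw [integral_const_mul, integral_exp_mul_Ioi (by linarith), Real.exp_add]
        have : Real.exp (k * s₀) * Real.exp (-k * s₀) = 1 := by
          rw [← Real.exp_add]; simp
        rw [neg_div_neg_eq, mul_assoc, mul_div_assoc', this]
        ring

/-! ### The maximal kernel along contracted orbits. -/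

namespace ExpandingFlow

variable (Φ : ExpandingFlow n)

/-- The maximal kernel `sup_{t > 0} (b + |w_t - x|)^{-n}` along the contracted curve
`w_t = flow (-t) u`. -/
def tubeKernel (b : ℝ) (x u : Rn n) : ℝ≥0∞ :=
  ⨆ t : Set.Ioi (0 : ℝ), ENNReal.ofReal ((b + ‖Φ.flow (-t) u - x‖)⁻¹ ^ n)

theorem continuous_flow_apply (t : ℝ) : Continuous (Φ.flow t) :=
  Φ.continuous_flow.comp (continuous_const.prodMk continuous_id)

theorem continuous_flow_time (x : Rn n) : Continuous fun t => Φ.flow t x :=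
  Φ.continuous_flow.comp (continuous_id.prodMk continuous_const)

theorem flow_neg_flow (t : ℝ) (x : Rn n) : Φ.flow (-t) (Φ.flow t x) = x := by
  rw [← Φ.flow_add, neg_add_cancel, Φ.flow_zero]

/-- The supremum is uncountable, but one of continuous functions, hence lower semicontinuous. -/
theorem measurable_tubeKernel {b : ℝ} (hb : 0 < b) :
    Measurable fun p : Rn n × Rn n => Φ.tubeKernel b p.1 p.2 := by
  refine LowerSemicontinuous.measurable (lowerSemicontinuous_iSup fun t => ?_)
  refine Continuous.lowerSemicontinuous (ENNReal.continuous_ofReal.comp ?_)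
  refine Continuous.pow (Continuous.inv₀ ?_ fun p => ?_) n
  · exact continuous_const.add
      (((Φ.continuous_flow_apply _).comp continuous_snd).sub continuous_fst).norm
  · positivity

theorem tubeKernel_le {b : ℝ} (hb : 0 < b) (x u : Rn n) :
    Φ.tubeKernel b x u ≤ ENNReal.ofReal (b⁻¹ ^ n) := by
  refine iSup_le fun t => ENNReal.ofReal_le_ofReal ?_
  gcongr
  simp

/-- Applying the bounded map flow (-s) to flow (-t) u - flow s z gives the difference at time t + s
from z, and t + s still competes in the supremum. -/
theorem tubeKernel_flow_le {b s : ℝ} (hb : 0 < b) (hs : 0 ≤ s) (z u : Rn n) :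
    Φ.tubeKernel b (Φ.flow s z) u ≤ ENNReal.ofReal (max 1 Φ.M ^ n) * Φ.tubeKernel b z u := by
  refine iSup_le fun t => ?_
  have ht : 0 < t.1 := t.2
  have hts : t.1 + s ∈ Set.Ioi (0 : ℝ) := by simp only [Set.mem_Ioi]; linarith
  refine le_trans ?_ (mul_le_mul_right (le_iSup (fun t : Set.Ioi (0 : ℝ) =>
    ENNReal.ofReal ((b + ‖Φ.flow (-t) u - z‖)⁻¹ ^ n)) ⟨t.1 + s, hts⟩) _)
  rw [← ENNReal.ofReal_mul (by positivity)]
  refine ENNReal.ofReal_le_ofReal ?_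
  have h1 : Φ.flow (-(t.1 + s)) u - z = Φ.flow (-s) (Φ.flow (-t.1) u - Φ.flow s z) := by
    rw [Φ.flow_sub, Φ.flow_neg_flow, ← Φ.flow_add]
    congr 2; ring
  have h2 := Φ.norm_flow_le (-s) (by linarith) (Φ.flow (-t.1) u - Φ.flow s z)
  rw [← h1] at h2
  simp only
  rw [← mul_pow]
  gcongr
  have hm : (0 : ℝ) < max 1 Φ.M := by positivity
  rw [inv_le_iff_one_le_mul₀ (by positivity), ← div_eq_mul_inv, div_mul_eq_mul_div,
    one_le_div (by positivity)]
  have h3 : Φ.M * ‖Φ.flow (-t.1) u - Φ.flow s z‖ ≤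
    max 1 Φ.M * ‖Φ.flow (-t.1) u - Φ.flow s z‖ := by gcongr; exact le_max_right _ _
  have h4 : 1 * b ≤ max 1 Φ.M * b := by gcongr; exact le_max_left _ _
  linarith

/-- The times at which the curve `flow (-t) u` lies in a given annulus. -/
def passage (u : Rn n) (c C : ℝ) : Set ℝ :=
  {t | c ≤ ‖Φ.flow (-t) u‖ ∧ ‖Φ.flow (-t) u‖ ≤ C}

/-- In the annulus the form is at most M C² r² and decreases along the curve at rate at least κ c²
r², so the elapsed time is bounded independently of r. -/
theorem volume_passage_le {c C : ℝ} (hc : 0 < c) {r : ℝ} (hr : 0 < r) (u : Rn n) :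
    volume (Φ.passage u (c * r) (C * r)) ≤ ENNReal.ofReal (Φ.M * C ^ 2 / (Φ.κ * c ^ 2)) := by
  have hM := Φ.M_pos
  have hκ := Φ.κ_pos
  have key : ∀ t ∈ Φ.passage u (c * r) (C * r), ∀ t' ∈ Φ.passage u (c * r) (C * r), t ≤ t' →
      t' - t ≤ Φ.M * C ^ 2 / (Φ.κ * c ^ 2) := by
    intro t ht t' ht' htt
    have h1 := Φ.form_flow_ge (t' - t) (by linarith) (Φ.flow (-t') u)
    have h2 : Φ.flow (t' - t) (Φ.flow (-t') u) = Φ.flow (-t) u := by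
      rw [← Φ.flow_add]; congr 1; ring
    rw [h2] at h1
    have h3 := Φ.form_le (Φ.flow (-t) u)
    have h4 : Φ.M * ‖Φ.flow (-t) u‖ ^ 2 ≤ Φ.M * (C * r) ^ 2 := by gcongr; exact ht.2
    have h5 : Φ.κ * (t' - t) * (c * r) ^ 2 ≤ Φ.κ * (t' - t) * ‖Φ.flow (-t') u‖ ^ 2 := by
      have : 0 ≤ t' - t := by linarith
      gcongr; exact ht'.1
    have h6 : 0 ≤ Φ.form (Φ.flow (-t') u) := le_trans (by positivity) (Φ.le_form _)
    rw [le_div_iff₀ (by positivity)]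
    have h7 : ((t' - t) * (Φ.κ * c ^ 2)) * r ^ 2 ≤ (Φ.M * C ^ 2) * r ^ 2 := by nlinarith
    exact le_of_mul_le_mul_right h7 (by positivity)
  refine (Real.volume_le_diam _).trans (Metric.ediam_le fun t ht t' ht' => ?_)
  rw [edist_dist, Real.dist_eq]
  refine ENNReal.ofReal_le_ofReal (abs_le.2 ?_)
  rcases le_total t t' with h | h
  · have := key t ht t' ht' h
    constructor <;> linarith
  · have := key t' ht' t ht h
    constructor <;> linarith

/-- A curve of speed ~ r keeps its distance to z comparable to 1/r + ρ for a time ~ (1/r + ρ)/r, so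
r times the time integral of the power -(n+1) recovers the power -n. Points of the curve far from z
contribute only r^{-n}. -/
theorem exists_tubeKernel_le_lintegral {c C : ℝ} (hc : 0 < c) (hC : 0 < C) :
    ∃ A c' C' : ℝ, 0 < A ∧ 0 < c' ∧ ∀ r : ℝ, 1 ≤ r → ∀ z : Rn n, c * r ≤ ‖z‖ → ‖z‖ ≤ C * r →
      ∀ u, Φ.tubeKernel r⁻¹ z u ≤ ENNReal.ofReal A * (ENNReal.ofReal r *
        (∫⁻ t in Φ.passage u (c' * r) (C' * r),
          ENNReal.ofReal ((r⁻¹ + ‖Φ.flow (-t) u - z‖)⁻¹ ^ (n + 1))) +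
            ENNReal.ofReal (r⁻¹ ^ n)) := by
  have hM := Φ.M_pos
  set L := Φ.M * (C + c) with hL
  have hL0 : 0 < L := by positivity
  -- Small enough that the time step h is at most 1 and the displacement at most c r / 4, which
  -- keeps the curve in an annulus.
  set ε := min 1 (c / (4 * L)) / (1 + c / 2) with hε
  have hε0 : 0 < ε := by positivity
  have hε1 : ε * (1 + c / 2) ≤ 1 := by
    rw [hε, div_mul_cancel₀ _ (by positivity)]; exact min_le_left _ _
  have hε2 : L * (ε * (1 + c / 2)) ≤ c / 4 := by
    rw [hε, div_mul_cancel₀ _ (by positivity)]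
    calc L * min 1 (c / (4 * L)) ≤ L * (c / (4 * L)) := by gcongr; exact min_le_right _ _
      _ = _ := by field_simp
  refine ⟨(2 / c) ^ n + (1 + L * ε) ^ (n + 1) / ε, c / 4, C + 2 * c, by positivity, by positivity,
    fun r hr z hz1 hz2 u => iSup_le fun t => ?_⟩
  have hr0 : 0 < r := by linarith
  set w := Φ.flow (-t.1) u with hw
  set ρ := ‖w - z‖ with hρ
  have hρ0 : 0 ≤ ρ := norm_nonneg _
  rcases le_total (c * r / 2) ρ with hcase | hcase
  · rw [mul_add]
    refine le_trans ?_ le_add_self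
    rw [← ENNReal.ofReal_mul (by positivity)]
    refine ENNReal.ofReal_le_ofReal ?_
    calc (r⁻¹ + ρ)⁻¹ ^ n ≤ (c * r / 2)⁻¹ ^ n := by
          gcongr
          have : 0 < r⁻¹ := by positivity
          linarith
      _ = (2 / c) ^ n * r⁻¹ ^ n := by rw [← mul_pow]; congr 1; field_simp
      _ ≤ _ := by
        gcongr
        have : 0 ≤ (1 + L * ε) ^ (n + 1) / ε := by positivity
        linarith
  · have hw1 : ‖w‖ ≤ (C + c) * r := by
      have := norm_sub_norm_le w z
      nlinarith
    have hw2 : c * r / 2 ≤ ‖w‖ := by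
      have := norm_sub_norm_le z w
      rw [norm_sub_rev] at this
      linarith
    have hrinv : r⁻¹ ≤ r := (inv_le_one_of_one_le₀ hr).trans hr
    have hrinv0 : 0 < r⁻¹ := by positivity
    set h := ε * (r⁻¹ + ρ) / r with hh
    have hh0 : 0 < h := by positivity
    have hsum : r⁻¹ + ρ ≤ (1 + c / 2) * r := by linarith
    have hh1 : h ≤ ε * (1 + c / 2) := by
      rw [hh, div_le_iff₀ hr0]
      nlinarith
    have hmove : ∀ τ ∈ Set.Icc 0 h, ‖Φ.flow (-(t.1 + τ)) u - w‖ ≤ L * ε * (r⁻¹ + ρ) := by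
      intro τ hτ
      have h1 : Φ.flow (-(t.1 + τ)) u = Φ.flow (-τ) w := by
        rw [hw, ← Φ.flow_add]; congr 1; ring
      rw [h1]
      have habs : |-τ| = τ := by rw [abs_neg, abs_of_nonneg hτ.1]
      have h2 := Φ.norm_flow_sub_le (-τ) (by rw [habs]; linarith [hτ.2]) w
      rw [habs] at h2
      calc _ ≤ Φ.M * τ * ‖w‖ := h2
        _ ≤ Φ.M * h * ((C + c) * r) := by gcongr; exact hτ.2
        _ = _ := by rw [hh, hL]; field_simp
    have hsmall : L * ε * (r⁻¹ + ρ) ≤ c / 4 * r := by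
      calc L * ε * (r⁻¹ + ρ) ≤ L * ε * ((1 + c / 2) * r) := by gcongr
        _ = L * (ε * (1 + c / 2)) * r := by ring
        _ ≤ _ := by gcongr
    have hsub : Set.Icc t.1 (t.1 + h) ⊆ Φ.passage u (c / 4 * r) ((C + 2 * c) * r) := by
      intro t' ht'
      have h1 := hmove (t' - t.1) ⟨by linarith [ht'.1], by linarith [ht'.2]⟩
      rw [add_sub_cancel] at h1
      have h2 := norm_sub_norm_le (Φ.flow (-t') u) w
      have h3 := norm_sub_norm_le w (Φ.flow (-t') u)
      rw [norm_sub_rev] at h3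
      constructor
      · nlinarith
      · nlinarith
    rw [mul_add]
    refine le_trans ?_ le_self_add
    have hlow : ENNReal.ofReal (((1 + L * ε) * (r⁻¹ + ρ))⁻¹ ^ (n + 1)) * ENNReal.ofReal h ≤
        ∫⁻ t in Φ.passage u (c / 4 * r) ((C + 2 * c) * r),
          ENNReal.ofReal ((r⁻¹ + ‖Φ.flow (-t) u - z‖)⁻¹ ^ (n + 1)) := by
      calc _ = ∫⁻ _t' in Set.Icc t.1 (t.1 + h),
            ENNReal.ofReal (((1 + L * ε) * (r⁻¹ + ρ))⁻¹ ^ (n + 1)) := by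
            rw [setLIntegral_const, Real.volume_Icc]; simp
        _ ≤ ∫⁻ t' in Set.Icc t.1 (t.1 + h),
            ENNReal.ofReal ((r⁻¹ + ‖Φ.flow (-t') u - z‖)⁻¹ ^ (n + 1)) := by
            refine setLIntegral_mono' measurableSet_Icc fun t' ht' => ?_
            refine ENNReal.ofReal_le_ofReal ?_
            gcongr
            have h1 := hmove (t' - t.1) ⟨by linarith [ht'.1], by linarith [ht'.2]⟩
            rw [add_sub_cancel] at h1
            have h2 : ‖Φ.flow (-t') u - z‖ ≤ ‖Φ.flow (-t') u - w‖ + ρ :=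
              norm_sub_le_norm_sub_add_norm_sub _ _ _
            nlinarith
        _ ≤ _ := lintegral_mono_set hsub
    refine le_trans ?_ (mul_le_mul_right (mul_le_mul_right hlow _) _)
    rw [← ENNReal.ofReal_mul (by positivity), ← ENNReal.ofReal_mul (by positivity),
      ← ENNReal.ofReal_mul (by positivity)]
    refine ENNReal.ofReal_le_ofReal ?_
    have h1 : (1 + L * ε) ^ (n + 1) / ε *
        (r * (((1 + L * ε) * (r⁻¹ + ρ))⁻¹ ^ (n + 1) * h)) = (r⁻¹ + ρ)⁻¹ ^ n := by
      rw [hh, mul_inv, mul_pow]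
      have hx : 0 < r⁻¹ + ρ := by positivity
      have hy : 0 < 1 + L * ε := by positivity
      generalize r⁻¹ + ρ = X at *
      generalize 1 + L * ε = Y at *
      rw [inv_pow, inv_pow, inv_pow]
      field_simp
      ring
    rw [← h1]
    gcongr
    have : 0 ≤ (2 / c) ^ n := by positivity
    linarith

/-- By Tonelli, the z-integral of the power -(n+1) gives r, the passage time is bounded, and the
factor r in front makes r². The remainder r^{-n} is integrated over volume O(r^n). -/
theorem exists_lintegral_tubeKernel_le {c C : ℝ} (hc : 0 < c) (hC : 0 < C) :
    ∃ A : ℝ, 0 < A ∧ ∀ r : ℝ, 1 ≤ r → ∀ u : Rn n,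
      ∫⁻ z in {z : Rn n | c * r ≤ ‖z‖ ∧ ‖z‖ ≤ C * r}, Φ.tubeKernel r⁻¹ z u ≤
        ENNReal.ofReal (A * r ^ 2) := by
  obtain ⟨A, c', C', hA, hc', hle⟩ := Φ.exists_tubeKernel_le_lintegral hc hC
  have hM := Φ.M_pos
  have hκ := Φ.κ_pos
  set J := ∫⁻ x : Rn n, ENNReal.ofReal ((1 + ‖x‖)⁻¹ ^ (n + 1)) with hJ
  have hJt : J ≠ ⊤ := (lintegral_inv_one_add_norm_pow_lt_top n).ne
  set V := volume (Metric.ball (0 : Rn n) 1) with hV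
  have hVt : V ≠ ⊤ := measure_ball_lt_top.ne
  set T := Φ.M * C' ^ 2 / (Φ.κ * c' ^ 2) with hT
  have hT0 : 0 ≤ T := by positivity
  refine ⟨A * (J.toReal * T + C ^ n * V.toReal) + 1, by positivity, fun r hr u => ?_⟩
  have hr0 : 0 < r := by linarith
  set N := {z : Rn n | c * r ≤ ‖z‖ ∧ ‖z‖ ≤ C * r} with hN
  have hNm : MeasurableSet N :=
    ((isClosed_le continuous_const continuous_norm).inter
      (isClosed_le continuous_norm continuous_const)).measurableSet
  have hcontz : Continuous fun p : Rn n × ℝ => (r⁻¹ + ‖Φ.flow (-p.2) u - p.1‖)⁻¹ ^ (n + 1) := by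
    refine Continuous.pow (Continuous.inv₀ ?_ fun p => by positivity) _
    exact continuous_const.add (((Φ.continuous_flow_time u).comp
      (continuous_neg.comp continuous_snd)).sub continuous_fst).norm
  have hmeas : Measurable fun p : Rn n × ℝ =>
      ENNReal.ofReal ((r⁻¹ + ‖Φ.flow (-p.2) u - p.1‖)⁻¹ ^ (n + 1)) :=
    ENNReal.measurable_ofReal.comp hcontz.measurable
  have hNvol : volume N ≤ ENNReal.ofReal ((C * r) ^ n) * V := by
    calc volume N ≤ volume (Metric.closedBall (0 : Rn n) (C * r)) :=
          measure_mono fun z hz => by simpa using hz.2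
      _ = _ := by
        rw [Measure.addHaar_closedBall _ _ (by positivity)]
        simp [hV]
  have hfirst : ∫⁻ z in N, ∫⁻ t in Φ.passage u (c' * r) (C' * r),
      ENNReal.ofReal ((r⁻¹ + ‖Φ.flow (-t) u - z‖)⁻¹ ^ (n + 1)) ≤
        ENNReal.ofReal r * J * ENNReal.ofReal T := by
    calc _ ≤ ∫⁻ z, ∫⁻ t in Φ.passage u (c' * r) (C' * r),
          ENNReal.ofReal ((r⁻¹ + ‖Φ.flow (-t) u - z‖)⁻¹ ^ (n + 1)) := setLIntegral_le_lintegral _ _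
      _ = ∫⁻ t in Φ.passage u (c' * r) (C' * r), ∫⁻ z,
          ENNReal.ofReal ((r⁻¹ + ‖Φ.flow (-t) u - z‖)⁻¹ ^ (n + 1)) :=
        lintegral_lintegral_swap hmeas.aemeasurable
      _ = ∫⁻ _t in Φ.passage u (c' * r) (C' * r), ENNReal.ofReal r * J := by
        refine lintegral_congr fun t => ?_
        rw [lintegral_inv_add_norm_sub_pow (by positivity), inv_inv]
      _ = ENNReal.ofReal r * J * volume (Φ.passage u (c' * r) (C' * r)) := setLIntegral_const _ _
      _ ≤ _ := by gcongr; exact Φ.volume_passage_le hc' hr0 u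
  calc ∫⁻ z in N, Φ.tubeKernel r⁻¹ z u
      ≤ ∫⁻ z in N, ENNReal.ofReal A * (ENNReal.ofReal r *
        (∫⁻ t in Φ.passage u (c' * r) (C' * r),
          ENNReal.ofReal ((r⁻¹ + ‖Φ.flow (-t) u - z‖)⁻¹ ^ (n + 1))) + ENNReal.ofReal (r⁻¹ ^ n)) :=
        setLIntegral_mono' hNm fun z hz => hle r hr z hz.1 hz.2 u
    _ = ENNReal.ofReal A * (ENNReal.ofReal r * (∫⁻ z in N,
        ∫⁻ t in Φ.passage u (c' * r) (C' * r),
          ENNReal.ofReal ((r⁻¹ + ‖Φ.flow (-t) u - z‖)⁻¹ ^ (n + 1))) +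
            ENNReal.ofReal (r⁻¹ ^ n) * volume N) := by
      rw [lintegral_const_mul' _ _ ENNReal.ofReal_ne_top, lintegral_add_right _ measurable_const,
        lintegral_const_mul' _ _ ENNReal.ofReal_ne_top, setLIntegral_const]
    _ ≤ ENNReal.ofReal A * (ENNReal.ofReal r * (ENNReal.ofReal r * J * ENNReal.ofReal T) +
        ENNReal.ofReal (r⁻¹ ^ n) * (ENNReal.ofReal ((C * r) ^ n) * V)) := by gcongr
    _ = ENNReal.ofReal (A * (r * (r * J.toReal * T) + r⁻¹ ^ n * ((C * r) ^ n * V.toReal))) := by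
      nth_rewrite 1 [← ENNReal.ofReal_toReal hJt, ← ENNReal.ofReal_toReal hVt]
      rw [← ENNReal.ofReal_mul (by positivity), ← ENNReal.ofReal_mul (by positivity),
        ← ENNReal.ofReal_mul (by positivity), ← ENNReal.ofReal_mul (by positivity),
        ← ENNReal.ofReal_mul (by positivity), ← ENNReal.ofReal_add (by positivity) (by positivity),
        ← ENNReal.ofReal_mul (by positivity)]
    _ ≤ _ := by
      refine ENNReal.ofReal_le_ofReal ?_
      have h1 : r⁻¹ ^ n * ((C * r) ^ n * V.toReal) = C ^ n * V.toReal := by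
        rw [mul_pow, inv_pow]; field_simp
      have h2 : (1 : ℝ) ≤ r ^ 2 := one_le_pow₀ hr
      rw [h1]
      have h3 : 0 ≤ C ^ n * V.toReal := by positivity
      have h4 : C ^ n * V.toReal ≤ C ^ n * V.toReal * r ^ 2 := le_mul_of_one_le_right h3 h2
      calc A * (r * (r * J.toReal * T) + C ^ n * V.toReal)
          ≤ A * (r * (r * J.toReal * T) + C ^ n * V.toReal * r ^ 2) := by gcongr
        _ = A * (J.toReal * T + C ^ n * V.toReal) * r ^ 2 := by ring
        _ ≤ _ := by gcongr; linarith

end ExpandingFlow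

/-! ### Weak type estimate for the Gaussian weight. -/

namespace ExpandingFlow

variable (Φ : ExpandingFlow n)

theorem form_nonneg (x : Rn n) : 0 ≤ Φ.form x :=
  le_trans (mul_nonneg Φ.κ_pos.le (sq_nonneg _)) (Φ.le_form x)

/-- The measure with density `e^{-form}`. -/
def weight : Measure (Rn n) :=
  volume.withDensity fun x => ENNReal.ofReal (Real.exp (-Φ.form x))

theorem exists_one_add_norm_pow_mul_exp_le (m : ℕ) :
    ∃ C : ℝ, 0 < C ∧ ∀ x, (1 + ‖x‖) ^ m * Real.exp (-(Φ.form x / 2)) ≤ C := by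
  have hκ := Φ.κ_pos
  obtain ⟨C, hC, h⟩ := exists_pow_mul_exp_neg_sq_le m (c := Φ.κ / 4) (by positivity)
  refine ⟨C * Real.exp (Φ.κ / 2), by positivity, fun x => ?_⟩
  have h1 := h (1 + ‖x‖) (by positivity)
  have h2 : Real.exp (-(Φ.form x / 2)) ≤
      Real.exp (-(Φ.κ / 4) * (1 + ‖x‖) ^ 2) * Real.exp (Φ.κ / 2) := by
    rw [← Real.exp_add]
    apply Real.exp_le_exp.2
    have := Φ.le_form x
    nlinarith [mul_nonneg hκ.le (sq_nonneg (1 - ‖x‖))]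
  calc _ ≤ (1 + ‖x‖) ^ m * (Real.exp (-(Φ.κ / 4) * (1 + ‖x‖) ^ 2) * Real.exp (Φ.κ / 2)) := by
        gcongr
    _ = ((1 + ‖x‖) ^ m * Real.exp (-(Φ.κ / 4) * (1 + ‖x‖) ^ 2)) * Real.exp (Φ.κ / 2) := by ring
    _ ≤ _ := by gcongr

theorem lintegral_exp_neg_half_form_lt_top :
    ∫⁻ x, ENNReal.ofReal (Real.exp (-(Φ.form x / 2))) < ⊤ := by
  obtain ⟨C, hC, h⟩ := Φ.exists_one_add_norm_pow_mul_exp_le (n + 1)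
  calc _ ≤ ∫⁻ x : Rn n, ENNReal.ofReal C * ENNReal.ofReal ((1 + ‖x‖)⁻¹ ^ (n + 1)) := by
        refine lintegral_mono fun x => ?_
        rw [← ENNReal.ofReal_mul hC.le]
        refine ENNReal.ofReal_le_ofReal ?_
        rw [inv_pow, ← div_eq_mul_inv, le_div_iff₀ (by positivity), mul_comm]
        exact h x
    _ < ⊤ := by
      rw [lintegral_const_mul' _ _ ENNReal.ofReal_ne_top]
      exact ENNReal.mul_lt_top ENNReal.ofReal_lt_top (lintegral_inv_one_add_norm_pow_lt_top n)

theorem exists_weight_tail_le :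
    ∃ W : ℝ, 0 < W ∧ ∀ a : ℝ, Φ.weight {x | a ≤ Φ.form x} ≤
      ENNReal.ofReal (W * Real.exp (-(a / 2))) := by
  have ht := Φ.lintegral_exp_neg_half_form_lt_top
  set I := ∫⁻ x, ENNReal.ofReal (Real.exp (-(Φ.form x / 2)))
  refine ⟨I.toReal + 1, by positivity, fun a => ?_⟩
  rw [weight, withDensity_apply']
  have hm : MeasurableSet {x | a ≤ Φ.form x} :=
    measurableSet_le measurable_const Φ.continuous_form.measurable
  calc _ ≤ ∫⁻ x in {x | a ≤ Φ.form x}, ENNReal.ofReal (Real.exp (-(a / 2))) *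
        ENNReal.ofReal (Real.exp (-(Φ.form x / 2))) := by
        refine setLIntegral_mono' hm fun x hx => ?_
        rw [← ENNReal.ofReal_mul (by positivity), ← Real.exp_add]
        refine ENNReal.ofReal_le_ofReal (Real.exp_le_exp.2 ?_)
        have : a ≤ Φ.form x := hx
        linarith
    _ = ENNReal.ofReal (Real.exp (-(a / 2))) * ∫⁻ x in {x | a ≤ Φ.form x},
        ENNReal.ofReal (Real.exp (-(Φ.form x / 2))) :=
      lintegral_const_mul' _ _ ENNReal.ofReal_ne_top
    _ ≤ ENNReal.ofReal (Real.exp (-(a / 2))) * I := by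
      gcongr; exact setLIntegral_le_lintegral _ _
    _ = ENNReal.ofReal (Real.exp (-(a / 2)) * I.toReal) := by
      rw [ENNReal.ofReal_mul (by positivity), ENNReal.ofReal_toReal ht.ne]
    _ ≤ _ := by
      refine ENNReal.ofReal_le_ofReal ?_
      have := Real.exp_pos (-(a / 2))
      nlinarith

theorem measurable_lintegral_tubeKernel {b : ℝ} (hb : 0 < b) (ν : Measure (Rn n)) [SFinite ν] :
    Measurable fun x => ∫⁻ u, Φ.tubeKernel b x u ∂ν :=
  (Φ.measurable_tubeKernel hb).lintegral_prod_right'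

/-- Averaging along the flow: the weight of a measurable set is controlled by the time integrals
of the weight along the pieces of orbits that lie in the set. -/
theorem weight_le_lintegral_orbit {A : Set (Rn n)} (hA : MeasurableSet A) :
    Φ.weight A ≤ ENNReal.ofReal Φ.M * ∫⁻ z, ∫⁻ s in {s | s ∈ Set.Icc (0 : ℝ) 1 ∧ Φ.flow s z ∈ A},
      ENNReal.ofReal (Real.exp (-Φ.form (Φ.flow s z))) := by
  set g : Rn n → ℝ≥0∞ := A.indicator fun x => ENNReal.ofReal (Real.exp (-Φ.form x)) with hg
  have hgm : Measurable g :=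
    (Φ.continuous_form.neg.rexp.measurable.ennreal_ofReal).indicator hA
  have hjoint : Measurable fun p : ℝ × Rn n => g (Φ.flow p.1 p.2) :=
    hgm.comp Φ.continuous_flow.measurable
  have h1 : Φ.weight A = ∫⁻ x, g x := by
    rw [weight, withDensity_apply _ hA, hg, lintegral_indicator hA]
  -- Since [0, 1] has length one, a trivial average over s is inserted, ready for the change of
  -- variables at each s.
  have h2 : ∫⁻ x, g x = ∫⁻ _s in Set.Icc (0 : ℝ) 1, ∫⁻ x, g x := by
    rw [setLIntegral_const, Real.volume_Icc]; simp
  rw [h1, h2]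
  calc _ ≤ ∫⁻ s in Set.Icc (0 : ℝ) 1, ENNReal.ofReal Φ.M * ∫⁻ z, g (Φ.flow s z) :=
        setLIntegral_mono' measurableSet_Icc fun s hs => Φ.lintegral_le s hs g hgm
    _ = ENNReal.ofReal Φ.M * ∫⁻ s in Set.Icc (0 : ℝ) 1, ∫⁻ z, g (Φ.flow s z) :=
      lintegral_const_mul' _ _ ENNReal.ofReal_ne_top
    _ = ENNReal.ofReal Φ.M * ∫⁻ z, ∫⁻ s in Set.Icc (0 : ℝ) 1, g (Φ.flow s z) := by
      rw [lintegral_lintegral_swap hjoint.aemeasurable]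
    _ = _ := by
      congr 1
      refine lintegral_congr fun z => ?_
      have hm : MeasurableSet {s | Φ.flow s z ∈ A} :=
        (Φ.continuous_flow_time z).measurable hA
      have : {s | s ∈ Set.Icc (0 : ℝ) 1 ∧ Φ.flow s z ∈ A} =
        {s | Φ.flow s z ∈ A} ∩ Set.Icc (0 : ℝ) 1 := by
        ext s; simp [and_comm]
      rw [this, ← setLIntegral_indicator hm]
      rfl

/-- Each orbit piece in the level set has weight O(G(z)/(a r²)), because the form grows along it at
rate ≳ r². The r^{-2} cancels the r² from `exists_lintegral_tubeKernel_le`. -/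
theorem exists_weight_levelSet_le :
    ∃ C : ℝ, 0 < C ∧ ∀ ν : Measure (Rn n), IsProbabilityMeasure ν → ∀ r : ℝ, 1 ≤ r →
      ∀ a : ℝ, 0 < a → Φ.weight {x | r ^ 2 ≤ Φ.form x ∧ Φ.form x ≤ 4 * r ^ 2 ∧
        ENNReal.ofReal a < ENNReal.ofReal (Real.exp (Φ.form x)) *
          ∫⁻ u, Φ.tubeKernel r⁻¹ x u ∂ν} ≤ ENNReal.ofReal (C / a) := by
  have hM := Φ.M_pos
  have hκ := Φ.κ_pos
  -- This annulus contains every z whose orbit meets the shell within time 1: r² ≤ M|flow s z|² ≤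
  -- M³|z|², and κ|z|² ≤ form z ≤ form (flow s z) ≤ 4r².
  obtain ⟨T, hT, htube⟩ := Φ.exists_lintegral_tubeKernel_le (c := √(1 / Φ.M ^ 3))
    (C := √(4 / Φ.κ)) (by positivity) (by positivity)
  set K := max 1 Φ.M ^ n with hK
  have hK0 : 0 < K := by positivity
  refine ⟨Φ.M * (K * (Φ.M / Φ.κ)) * T, by positivity, fun ν hν r hr a ha => ?_⟩
  have hr0 : 0 < r := by linarith
  have hb : 0 < r⁻¹ := by positivity
  have hGm := Φ.measurable_lintegral_tubeKernel hb ν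
  set G : Rn n → ℝ≥0∞ := fun x => ∫⁻ u, Φ.tubeKernel r⁻¹ x u ∂ν with hG
  set A := {x | r ^ 2 ≤ Φ.form x ∧ Φ.form x ≤ 4 * r ^ 2 ∧
        ENNReal.ofReal a < ENNReal.ofReal (Real.exp (Φ.form x)) * G x} with hA
  have hfm := Φ.continuous_form.measurable
  have hAm : MeasurableSet A := by
    have h : Measurable fun x => ENNReal.ofReal (Real.exp (Φ.form x)) * G x :=
      hfm.exp.ennreal_ofReal.mul hGm
    exact (measurableSet_le measurable_const hfm).inter
      ((measurableSet_le hfm measurable_const).inter (measurableSet_lt measurable_const h))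
  set N := {z : Rn n | √(1 / Φ.M ^ 3) * r ≤ ‖z‖ ∧ ‖z‖ ≤ √(4 / Φ.κ) * r} with hN
  have hNm : MeasurableSet N :=
    ((isClosed_le continuous_const continuous_norm).inter
      (isClosed_le continuous_norm continuous_const)).measurableSet
  have hGtop : ∀ z, G z ≠ ⊤ := by
    intro z
    refine ne_of_lt (lt_of_le_of_lt (lintegral_mono fun u => Φ.tubeKernel_le hb z u) ?_)
    simp
  have hAnorm : ∀ x ∈ A, r ^ 2 ≤ Φ.M * ‖x‖ ^ 2 := fun x hx => hx.1.trans (Φ.form_le x)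
  have horbit : ∀ z, ∫⁻ s in {s | s ∈ Set.Icc (0 : ℝ) 1 ∧ Φ.flow s z ∈ A},
      ENNReal.ofReal (Real.exp (-Φ.form (Φ.flow s z))) ≤
        N.indicator (fun z => ENNReal.ofReal (K * (Φ.M / Φ.κ) / (a * r ^ 2)) * G z) z := by
    intro z
    set S := {s | s ∈ Set.Icc (0 : ℝ) 1 ∧ Φ.flow s z ∈ A} with hS
    rcases S.eq_empty_or_nonempty with hSe | ⟨s₁, hs₁⟩
    · rw [hSe]; simp
    have hzN : z ∈ N := by
      have h1 := Φ.form_flow_ge s₁ hs₁.1.1 z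
      have h2 : Φ.form (Φ.flow s₁ z) ≤ 4 * r ^ 2 := hs₁.2.2.1
      have h3 := Φ.le_form z
      have h4 := Φ.norm_flow_le s₁ hs₁.1.2 z
      have h5 := hAnorm _ hs₁.2
      have h7 : 0 ≤ Φ.κ * s₁ * ‖z‖ ^ 2 := by
        have := hs₁.1.1
        positivity
      constructor
      · have h6 : r ^ 2 ≤ Φ.M ^ 3 * ‖z‖ ^ 2 := by
          calc r ^ 2 ≤ Φ.M * ‖Φ.flow s₁ z‖ ^ 2 := h5
            _ ≤ Φ.M * (Φ.M * ‖z‖) ^ 2 := by gcongr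
            _ = _ := by ring
        refine abs_le_of_sq_le_sq' ?_ (norm_nonneg _) |>.2
        rw [mul_pow, Real.sq_sqrt (by positivity), one_div, inv_mul_le_iff₀ (by positivity)]
        exact h6
      · refine abs_le_of_sq_le_sq' ?_ (by positivity) |>.2
        rw [mul_pow, Real.sq_sqrt (by positivity), div_mul_eq_mul_div, le_div_iff₀ hκ]
        linarith
    rw [Set.indicator_of_mem hzN]
    set g := (G z).toReal with hg
    have hGz : G z = ENNReal.ofReal g := (ENNReal.ofReal_toReal (hGtop z)).symm
    have hg0 : 0 ≤ g := ENNReal.toReal_nonneg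
    -- G is frozen at z, so the level condition becomes a lower bound for the form alone along the
    -- orbit.
    have hlev : ∀ s ∈ S, a < Real.exp (Φ.form (Φ.flow s z)) * (K * g) := by
      intro s hs
      have h1 := hs.2.2.2
      have h2 : G (Φ.flow s z) ≤ ENNReal.ofReal K * G z := by
        calc G (Φ.flow s z) ≤ ∫⁻ u, ENNReal.ofReal K * Φ.tubeKernel r⁻¹ z u ∂ν :=
              lintegral_mono fun u => Φ.tubeKernel_flow_le hb hs.1.1 z u
          _ = _ := lintegral_const_mul' _ _ ENNReal.ofReal_ne_top
      have h3 := h1.trans_le (mul_le_mul_right h2 _)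
      rw [hGz, ← ENNReal.ofReal_mul hK0.le, ← ENNReal.ofReal_mul (by positivity)] at h3
      exact (ENNReal.ofReal_lt_ofReal_iff_of_nonneg ha.le).1 h3
    have hgpos : 0 < g := by
      rcases hg0.eq_or_lt with h | h
      · have := hlev s₁ hs₁
        rw [← h] at this
        simp at this
        linarith
      · exact h
    have hSm : MeasurableSet S :=
      measurableSet_Icc.inter ((Φ.continuous_flow_time z).measurable hAm)
    have hk : 0 < Φ.κ / Φ.M * r ^ 2 := by positivity
    have hmain := lintegral_exp_neg_le_of_growth (φ := fun s => Φ.form (Φ.flow s z)) (S := S)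
      (a := Real.log (a / (K * g))) (k := Φ.κ / Φ.M * r ^ 2) hSm
      ⟨0, fun s hs => hs.1.1⟩ hk
      (fun s hs => by
        rw [Real.log_le_iff_le_exp (by positivity), div_le_iff₀ (by positivity)]
        exact (hlev s hs).le)
      (fun s hs s' hs' hss => by
        have h1 := Φ.form_flow_ge (s' - s) (by linarith) (Φ.flow s z)
        rw [← Φ.flow_add, sub_add_cancel] at h1
        have h2 := hAnorm _ hs.2
        refine le_trans ?_ h1
        have h3 : Φ.κ / Φ.M * r ^ 2 ≤ Φ.κ * ‖Φ.flow s z‖ ^ 2 := by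
          rw [div_mul_eq_mul_div, div_le_iff₀ hM]
          nlinarith
        have h4 : 0 ≤ s' - s := by linarith
        nlinarith)
    refine hmain.trans (le_of_eq ?_)
    rw [hGz, ← ENNReal.ofReal_mul (by positivity), Real.exp_neg, Real.exp_log (by positivity)]
    congr 1
    field_simp
  calc Φ.weight A ≤ _ := Φ.weight_le_lintegral_orbit hAm
    _ ≤ ENNReal.ofReal Φ.M * ∫⁻ z,
        N.indicator (fun z => ENNReal.ofReal (K * (Φ.M / Φ.κ) / (a * r ^ 2)) * G z) z := by
      gcongr with z; exact horbit z
    _ = ENNReal.ofReal Φ.M * (ENNReal.ofReal (K * (Φ.M / Φ.κ) / (a * r ^ 2)) *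
        ∫⁻ z in N, G z) := by
      rw [lintegral_indicator hNm, lintegral_const_mul' _ _ ENNReal.ofReal_ne_top]
    _ = ENNReal.ofReal Φ.M * (ENNReal.ofReal (K * (Φ.M / Φ.κ) / (a * r ^ 2)) *
        ∫⁻ u, (∫⁻ z in N, Φ.tubeKernel r⁻¹ z u) ∂ν) := by
      rw [hG, lintegral_lintegral_swap (Φ.measurable_tubeKernel hb).aemeasurable]
    _ ≤ ENNReal.ofReal Φ.M * (ENNReal.ofReal (K * (Φ.M / Φ.κ) / (a * r ^ 2)) *
        ∫⁻ _u, ENNReal.ofReal (T * r ^ 2) ∂ν) := by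
      gcongr with u; exact htube r hr u
    _ = _ := by
      rw [lintegral_const, measure_univ, mul_one, ← ENNReal.ofReal_mul (by positivity),
        ← ENNReal.ofReal_mul (by positivity)]
      congr 1
      field_simp

/-- Weak type `(1,1)` with respect to `weight` for kernels dominated by the maximal kernel. -/
theorem exists_weight_lintegral_kernel_gt_le {C₁ : ℝ} (hC₁ : 0 < C₁) :
    ∃ C : ℝ, 0 < C ∧ ∀ k : Rn n → Rn n → ℝ≥0∞,
      (∀ x u, k x u ≤ ENNReal.ofReal (C₁ * Real.exp (Φ.form x) * (1 + ‖x‖) ^ n)) →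
      (∀ r : ℝ, 1 ≤ r → ∀ x, Φ.form x ≤ 4 * r ^ 2 → ∀ u,
        k x u ≤ ENNReal.ofReal (C₁ * Real.exp (Φ.form x)) * Φ.tubeKernel r⁻¹ x u) →
      ∀ ν : Measure (Rn n), IsProbabilityMeasure ν → ∀ a : ℝ, 0 < a →
        Φ.weight {x | ENNReal.ofReal a < ∫⁻ u, k x u ∂ν} ≤ ENNReal.ofReal (C / a) := by
  obtain ⟨C₀, hC₀, hlev⟩ := Φ.exists_weight_levelSet_le
  obtain ⟨W, hW, htail⟩ := Φ.exists_weight_tail_le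
  obtain ⟨P, hP, hpoly⟩ := Φ.exists_one_add_norm_pow_mul_exp_le n
  set C₂ := C₁ * P with hC₂
  have hC₂0 : 0 < C₂ := by positivity
  refine ⟨W * C₂ * Real.exp 2 + C₀ * C₁, by positivity, fun k hk1 hk2 ν hν a ha => ?_⟩
  have hlow : ∀ x, ENNReal.ofReal a < ∫⁻ u, k x u ∂ν → a < C₂ * Real.exp (2 * Φ.form x) := by
    intro x hx
    have h1 : ∫⁻ u, k x u ∂ν ≤ ENNReal.ofReal (C₁ * Real.exp (Φ.form x) * (1 + ‖x‖) ^ n) :=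
      (lintegral_mono fun u => hk1 x u).trans (by simp)
    have h2 := (ENNReal.ofReal_lt_ofReal_iff_of_nonneg ha.le).1 (hx.trans_le h1)
    refine h2.trans_le ?_
    have h3 : (1 + ‖x‖) ^ n ≤ P * Real.exp (Φ.form x) := by
      have h4 := hpoly x
      have h5 : Real.exp (-(Φ.form x / 2)) * Real.exp (Φ.form x / 2) = 1 := by
        rw [← Real.exp_add]; simp
      calc (1 + ‖x‖) ^ n = (1 + ‖x‖) ^ n *
            (Real.exp (-(Φ.form x / 2)) * Real.exp (Φ.form x / 2)) := by rw [h5, mul_one]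
        _ = ((1 + ‖x‖) ^ n * Real.exp (-(Φ.form x / 2))) * Real.exp (Φ.form x / 2) := by ring
        _ ≤ P * Real.exp (Φ.form x) := by
          gcongr
          linarith [Φ.form_nonneg x]
    calc C₁ * Real.exp (Φ.form x) * (1 + ‖x‖) ^ n
        ≤ C₁ * Real.exp (Φ.form x) * (P * Real.exp (Φ.form x)) := by gcongr
      _ = _ := by rw [two_mul, Real.exp_add]; ring
  -- For small a the finite total mass is enough; large a makes β > 1 and hence r ≥ 1.
  rcases le_or_gt a (C₂ * Real.exp 2) with hsmall | hbig
  · calc _ ≤ Φ.weight {x | 0 ≤ Φ.form x} := measure_mono fun x _ => Φ.form_nonneg x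
      _ ≤ ENNReal.ofReal (W * Real.exp (-(0 / 2))) := htail 0
      _ ≤ _ := by
        refine ENNReal.ofReal_le_ofReal ?_
        rw [le_div_iff₀ ha]
        have : 0 < C₀ * C₁ := by positivity
        simp only [zero_div, neg_zero, Real.exp_zero, mul_one]
        nlinarith
  · set β := Real.log (a / C₂) / 2 with hβ
    have hβ1 : 1 < β := by
      rw [hβ, lt_div_iff₀ (by norm_num), one_mul, Real.lt_log_iff_exp_lt (by positivity),
        lt_div_iff₀ hC₂0]
      linarith
    have hexpβ : Real.exp (2 * β) = a / C₂ := by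
      rw [hβ, mul_div_cancel₀ _ (by norm_num), Real.exp_log (by positivity)]
    set r := √β with hr
    have hr2 : r ^ 2 = β := Real.sq_sqrt (by linarith)
    have hr1 : 1 ≤ r := Real.one_le_sqrt.2 hβ1.le
    have hsub : {x | ENNReal.ofReal a < ∫⁻ u, k x u ∂ν} ⊆ {x | 4 * β ≤ Φ.form x} ∪
        {x | r ^ 2 ≤ Φ.form x ∧ Φ.form x ≤ 4 * r ^ 2 ∧
          ENNReal.ofReal (a / C₁) < ENNReal.ofReal (Real.exp (Φ.form x)) *
            ∫⁻ u, Φ.tubeKernel r⁻¹ x u ∂ν} := by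
      intro x hx
      have hx' : ENNReal.ofReal a < ∫⁻ u, k x u ∂ν := hx
      rcases le_total (4 * β) (Φ.form x) with h | h
      · exact Or.inl h
      refine Or.inr ⟨?_, by rw [hr2]; exact h, ?_⟩
      · have h1 := hlow x hx'
        rw [hr2, hβ, div_le_iff₀ (by norm_num), Real.log_le_iff_le_exp (by positivity),
          div_le_iff₀ hC₂0, mul_comm, mul_comm (Φ.form x)]
        exact h1.le
      · have h1 : ∫⁻ u, k x u ∂ν ≤ ENNReal.ofReal (C₁ * Real.exp (Φ.form x)) *
            ∫⁻ u, Φ.tubeKernel r⁻¹ x u ∂ν := by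
          rw [← lintegral_const_mul' _ _ ENNReal.ofReal_ne_top]
          exact lintegral_mono fun u => hk2 r hr1 x (by rw [hr2]; exact h) u
        have h2 := hx'.trans_le h1
        rw [ENNReal.ofReal_mul hC₁.le, mul_assoc, mul_comm] at h2
        rw [ENNReal.ofReal_div_of_pos hC₁]
        exact ENNReal.div_lt_of_lt_mul h2
    calc _ ≤ _ := measure_mono hsub
      _ ≤ _ := measure_union_le _ _
      _ ≤ ENNReal.ofReal (W * Real.exp (-(4 * β / 2))) + ENNReal.ofReal (C₀ / (a / C₁)) :=
        add_le_add (htail _) (hlev ν hν r hr1 _ (by positivity))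
      _ = ENNReal.ofReal (W * C₂ / a + C₀ * C₁ / a) := by
        rw [← ENNReal.ofReal_add (by positivity) (by positivity)]
        congr 2
        · have : 4 * β / 2 = 2 * β := by ring
          rw [this, Real.exp_neg, hexpβ]
          field_simp
        · field_simp
      _ ≤ _ := by
        refine ENNReal.ofReal_le_ofReal ?_
        rw [← add_div]
        have h : W * C₂ ≤ W * C₂ * Real.exp 2 :=
          le_mul_of_one_le_right (by positivity) (Real.one_le_exp (by norm_num))
        gcongr

end ExpandingFlow

/-! ### Geometry of the localization. -/

namespace Localization

variable (L : Localization n)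

theorem finite_support_rho (u : Rn n) : (Function.support fun j => L.rho j u).Finite := by
  -- If u ∈ 4B_j then |x_j| ≤ |u| + 4, so B_j has radius at least δ. Only finitely many such
  -- disjoint balls fit into a bounded set.
  set δ := 1 / (5 + ‖u‖) with hδ
  have hδ0 : 0 < δ := by positivity
  set U := Metric.ball (0 : Rn n) (‖u‖ + 6) with hU
  have hfin := Measure.finite_const_le_meas_of_disjoint_iUnion (volume : Measure (Rn n))
    (ε := volume (Metric.ball (0 : Rn n) δ)) (Metric.measure_ball_pos _ _ hδ0)
    (As := fun j => scaledBall 1 (L.center j) ∩ U)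
    (fun j => Metric.isOpen_ball.measurableSet.inter Metric.isOpen_ball.measurableSet)
    (fun i j hij => (L.disjoint_balls hij).mono Set.inter_subset_left Set.inter_subset_left)
    (ne_top_of_le_ne_top (measure_ball_lt_top (x := (0 : Rn n)) (r := ‖u‖ + 6)).ne
      (measure_mono (Set.iUnion_subset fun j => Set.inter_subset_right)))
  refine hfin.subset fun j hj => ?_
  have hu := L.rho_support j hj
  simp only [scaledBall, Metric.mem_ball, dist_eq_norm] at hu
  have hc : 0 < 1 + ‖L.center j‖ := by positivity
  have h4 : 4 / (1 + ‖L.center j‖) ≤ 4 :=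
    div_le_self (by norm_num) (by linarith [norm_nonneg (L.center j)])
  have hcu : ‖L.center j‖ ≤ ‖u‖ + 4 := by
    have := norm_sub_norm_le (L.center j) u
    rw [norm_sub_rev] at this
    linarith
  have hle1 : 1 / (1 + ‖L.center j‖) ≤ 1 :=
    div_le_self (by norm_num) (by linarith [norm_nonneg (L.center j)])
  have hsub : Metric.ball (L.center j) δ ⊆ scaledBall 1 (L.center j) ∩ U := by
    intro y hy
    have hy1 : y ∈ scaledBall 1 (L.center j) :=
      Metric.ball_subset_ball (one_div_le_one_div_of_le hc (by linarith)) hy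
    refine ⟨hy1, ?_⟩
    simp only [scaledBall, Metric.mem_ball, dist_eq_norm] at hy1
    rw [hU, mem_ball_zero_iff]
    have := norm_sub_norm_le y (L.center j)
    linarith
  change volume (Metric.ball (0 : Rn n) δ) ≤ _
  rw [← Measure.addHaar_ball_center volume (L.center j)]
  exact measure_mono hsub

theorem summable_rho (u : Rn n) : Summable fun j => L.rho j u :=
  summable_of_hasFiniteSupport (L.finite_support_rho u)

theorem exists_mem_scaledBall_three (u : Rn n) : ∃ j, u ∈ scaledBall 3 (L.center j) := by
  obtain ⟨j, hj⟩ := L.maximal u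
  rw [Set.not_disjoint_iff] at hj
  obtain ⟨y, hy1, hy2⟩ := hj
  simp only [scaledBall, Metric.mem_ball, dist_eq_norm] at hy1 hy2
  have hu0 := norm_nonneg u
  have hj0 := norm_nonneg (L.center j)
  have hdist : ‖u - L.center j‖ < 1 / (1 + ‖u‖) + 1 / (1 + ‖L.center j‖) := by
    have := norm_sub_le_norm_sub_add_norm_sub u y (L.center j)
    rw [norm_sub_rev u y] at this
    linarith
  -- The ball 3B_0 = B(0, 3) covers small u. For |u| ≥ 3 the radius at u is at most twice that of
  -- B_j, as 3B_j requires.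
  by_cases hbig : ‖u‖ < 3
  · refine ⟨0, ?_⟩
    simpa [scaledBall, L.center_zero] using hbig
  · refine ⟨j, ?_⟩
    simp only [scaledBall, Metric.mem_ball, dist_eq_norm]
    refine hdist.trans_le ?_
    have h1 : 1 / (1 + ‖u‖) ≤ 1 := div_le_self (by norm_num) (by linarith)
    have h2 : 1 / (1 + ‖L.center j‖) ≤ 1 := div_le_self (by norm_num) (by linarith)
    have h3 : ‖L.center j‖ ≤ ‖u‖ + 2 := by
      have := norm_sub_norm_le (L.center j) u
      rw [norm_sub_rev] at this
      linarith
    have h4 : 1 / (1 + ‖u‖) ≤ 2 / (1 + ‖L.center j‖) := by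
      rw [div_le_div_iff₀ (by positivity) (by positivity)]
      linarith
    have h5 : (3 : ℝ) / (1 + ‖L.center j‖) = 2 / (1 + ‖L.center j‖) + 1 / (1 + ‖L.center j‖) := by
      ring
    linarith

theorem tsum_rho_pos (u : Rn n) : 0 < ∑' j, L.rho j u := by
  obtain ⟨j, hj⟩ := L.exists_mem_scaledBall_three u
  exact (L.summable_rho u).tsum_pos (fun i => L.rho_nonneg i u) j
    (by rw [L.rho_eq_one j u hj]; exact one_pos)

theorem tsum_part (u : Rn n) : ∑' j, L.part j u = 1 := by
  simp only [part]
  rw [tsum_div_const, div_self (L.tsum_rho_pos u).ne']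

theorem eta_nonneg (x u : Rn n) : 0 ≤ L.eta x u :=
  tsum_nonneg fun j => mul_nonneg (L.outer_mem j x).1
    (div_nonneg (L.rho_nonneg j u) (L.tsum_rho_pos u).le)

/-- Since the r_j sum to 1, η ≠ 1 yields some j with u ∈ 4B_j and x ∉ 5B_j, so |x - u| is at least
the radius of B_j. The bound involves no other feature of the localization. -/
theorem le_norm_sub_of_eta_ne_one {x u : Rn n} (h : L.eta x u ≠ 1) :
    1 / 10 ≤ ‖x - u‖ * (1 + ‖x‖) := by
  obtain ⟨j, hj1, hj2⟩ : ∃ j, L.rho j u ≠ 0 ∧ L.outer j x ≠ 1 := by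
    by_contra! hcon
    refine h ?_
    rw [← L.tsum_part u, eta]
    refine tsum_congr fun j => ?_
    by_cases hj : L.rho j u = 0
    · simp [part, hj]
    · rw [hcon j hj, one_mul]
  have hu := L.rho_support j hj1
  have hx : x ∉ scaledBall 5 (L.center j) := fun hx => hj2 (L.outer_eq_one j x hx)
  simp only [scaledBall, Metric.mem_ball, dist_eq_norm, not_lt] at hu hx
  have hc0 := norm_nonneg (L.center j)
  have hx0 := norm_nonneg x
  have h4 : 4 / (1 + ‖L.center j‖) ≤ 4 := div_le_self (by norm_num) (by linarith)
  have hcu : ‖L.center j‖ ≤ ‖u‖ + 4 := by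
    have := norm_sub_norm_le (L.center j) u
    rw [norm_sub_rev] at this
    linarith
  have hd : 1 / (1 + ‖L.center j‖) ≤ ‖x - u‖ := by
    have h1 := norm_sub_le_norm_sub_add_norm_sub x u (L.center j)
    have h5 : (5 : ℝ) / (1 + ‖L.center j‖) = 4 / (1 + ‖L.center j‖) + 1 / (1 + ‖L.center j‖) := by
      ring
    linarith
  have hux : ‖u‖ ≤ ‖x‖ + ‖x - u‖ := by
    have := norm_sub_norm_le u x
    rw [norm_sub_rev] at this
    linarith
  rw [div_le_iff₀ (by positivity)] at hd
  have hd0 := norm_nonneg (x - u)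
  -- In the first case 1 + |x_j| ≤ 5 + |x| + |x - u| ≤ 6(1 + |x|); in the second the product is
  -- already at least 1.
  rcases le_total ‖x - u‖ (1 + ‖x‖) with hle | hle
  · nlinarith
  · nlinarith

end Localization

/-! ### Domination by the maximal kernel in the global region. -/

namespace ExpandingFlow

/-- Away from the local region, bounds at the natural time scale and in terms of the distance to the
contracted curve combine to the bounds defining kernels dominated by the maximal kernel. -/
theorem exists_kernel_bounds (Φ : ExpandingFlow n) {C : ℝ} (hC : 0 < C) :
    ∃ C₁ : ℝ, 0 < C₁ ∧ ∀ t : ℝ, 0 < t → ∀ x u : Rn n, 1 / 10 ≤ ‖x - u‖ * (1 + ‖x‖) →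
      ∀ K : ℝ, 0 ≤ K → K * √(min 1 t) ^ n ≤ C * Real.exp (Φ.form x) →
      K * ‖Φ.flow (-t) u - x‖ ^ n ≤ C * Real.exp (Φ.form x) →
      K ≤ C₁ * Real.exp (Φ.form x) * (1 + ‖x‖) ^ n ∧
      ∀ r : ℝ, 1 ≤ r → Φ.form x ≤ 4 * r ^ 2 →
        K ≤ C₁ * Real.exp (Φ.form x) * (r⁻¹ + ‖Φ.flow (-t) u - x‖)⁻¹ ^ n := by
  have hM := Φ.M_pos
  have hκ := Φ.κ_pos
  -- Makes the drift term M e at most 1/20, half of the separation 1/10.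
  set e := min 1 (1 / (20 * Φ.M)) with he
  have he0 : 0 < e := by positivity
  have he1 : e ≤ 1 := min_le_left _ _
  have he2 : e * (20 * Φ.M) ≤ 1 := by
    have h : e ≤ 1 / (20 * Φ.M) := min_le_right _ _
    rwa [le_div_iff₀ (by positivity)] at h
  set Y := 1 + √(4 / Φ.κ) with hY
  have hY0 : 0 < Y := by positivity
  set C₀ := C * e⁻¹ ^ n with hC₀
  have hC₀0 : 0 < C₀ := by positivity
  have h2n : (1 : ℝ) ≤ 2 ^ n := one_le_pow₀ (by norm_num)
  refine ⟨C₀ + 2 ^ n * (C₀ * Y ^ n + C), by positivity, fun t ht x u hxu K hK h1 h2 => ?_⟩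
  set ρ := ‖Φ.flow (-t) u - x‖ with hρ
  have hρ0 : 0 ≤ ρ := norm_nonneg _
  set y := 1 + ‖x‖ with hy
  have hy1 : 1 ≤ y := by rw [hy]; linarith [norm_nonneg x]
  have hy0 : 0 < y := by linarith
  have hE := Real.exp_pos (Φ.form x)
  have hfirst : K ≤ C₀ * Real.exp (Φ.form x) * y ^ n := by
    have key : ∀ q : ℝ, e / y ≤ q → K * q ^ n ≤ C * Real.exp (Φ.form x) →
        K ≤ C₀ * Real.exp (Φ.form x) * y ^ n := by
      intro q hq hKq
      have h3 : K * (e / y) ^ n ≤ C * Real.exp (Φ.form x) := le_trans (by gcongr) hKq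
      calc K = K * (e / y) ^ n * (e⁻¹ ^ n * y ^ n) := by
            rw [mul_assoc, ← mul_pow, ← mul_pow]
            have : e / y * (e⁻¹ * y) = 1 := by field_simp
            rw [this, one_pow, mul_one]
        _ ≤ C * Real.exp (Φ.form x) * (e⁻¹ ^ n * y ^ n) := by gcongr
        _ = _ := by rw [hC₀]; ring
    -- If t is not small, the bound at the time scale applies. Otherwise x moves by at most M e / y
    -- under flow t, so the separation of x and u must come from ρ, and the distance bound applies
    -- with ρ ≥ e / y.
    by_cases hcase : (e / y) ^ 2 ≤ min 1 t
    · exact key _ (Real.le_sqrt_of_sq_le hcase) h1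
    · have hey : (e / y) ^ 2 ≤ 1 := by
        refine pow_le_one₀ (by positivity) ?_
        rw [div_le_one hy0]; linarith
      have hty : t < (e / y) ^ 2 := by
        by_contra hcon
        exact hcase (le_min hey (not_lt.1 hcon))
      refine key ρ ?_ h2
      have hback : ‖Φ.flow t (Φ.flow (-t) u - x)‖ ≤ Φ.M * ρ :=
        Φ.norm_flow_le t (by linarith) _
      have hflow : Φ.flow t (Φ.flow (-t) u - x) = u - Φ.flow t x := by
        rw [Φ.flow_sub, ← Φ.flow_add, add_neg_cancel, Φ.flow_zero]
      rw [hflow] at hback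
      have hmove := Φ.norm_flow_sub_le t (by rw [abs_of_pos ht]; linarith) x
      rw [abs_of_pos ht] at hmove
      have htri : ‖x - u‖ ≤ ‖u - Φ.flow t x‖ + ‖Φ.flow t x - x‖ := by
        rw [norm_sub_rev x u]
        exact norm_sub_le_norm_sub_add_norm_sub _ _ _
      have hxy : ‖x‖ ≤ y := by rw [hy]; linarith
      have hm2 : Φ.M * t * ‖x‖ * y ≤ Φ.M * e := by
        calc Φ.M * t * ‖x‖ * y ≤ Φ.M * (e / y) ^ 2 * y * y := by gcongr
          _ = Φ.M * e * e := by field_simp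
          _ ≤ Φ.M * e * 1 := by gcongr
          _ = _ := mul_one _
      rw [div_le_iff₀ hy0]
      have hfin : 1 / 10 ≤ Φ.M * ρ * y + Φ.M * e := by
        calc 1 / 10 ≤ ‖x - u‖ * y := hxu
          _ ≤ (Φ.M * ρ + Φ.M * t * ‖x‖) * y := by gcongr; linarith
          _ = Φ.M * ρ * y + Φ.M * t * ‖x‖ * y := by ring
          _ ≤ _ := by linarith
      have : Φ.M * e ≤ Φ.M * (ρ * y) := by nlinarith
      exact le_of_mul_le_mul_left this hM
  constructor
  · refine hfirst.trans ?_
    gcongr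
    have : 0 ≤ 2 ^ n * (C₀ * Y ^ n + C) := by positivity
    linarith
  · intro r hr hform
    have hr0 : 0 < r := by linarith
    have hyr : y ≤ Y * r := by
      have h3 : ‖x‖ ≤ √(4 / Φ.κ) * r := by
        refine abs_le_of_sq_le_sq' ?_ (by positivity) |>.2
        rw [mul_pow, Real.sq_sqrt (by positivity), div_mul_eq_mul_div, le_div_iff₀ hκ]
        linarith [Φ.le_form x]
      rw [hy, hY]
      nlinarith
    have hr' : K * r⁻¹ ^ n ≤ C₀ * Y ^ n * Real.exp (Φ.form x) := by
      calc K * r⁻¹ ^ n ≤ C₀ * Real.exp (Φ.form x) * (Y * r) ^ n * r⁻¹ ^ n := by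
            gcongr
            exact hfirst.trans (by gcongr)
        _ = _ := by rw [mul_pow, inv_pow]; field_simp
    have hsum : K * (r⁻¹ + ρ) ^ n ≤ 2 ^ n * (C₀ * Y ^ n + C) * Real.exp (Φ.form x) := by
      have h3 : (r⁻¹ + ρ) ^ n ≤ 2 ^ n * (r⁻¹ ^ n + ρ ^ n) := by
        refine (add_pow_le (by positivity) hρ0 n).trans ?_
        gcongr
        · norm_num
        · omega
      calc K * (r⁻¹ + ρ) ^ n ≤ K * (2 ^ n * (r⁻¹ ^ n + ρ ^ n)) := by gcongr
        _ = 2 ^ n * (K * r⁻¹ ^ n + K * ρ ^ n) := by ring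
        _ ≤ 2 ^ n * (C₀ * Y ^ n * Real.exp (Φ.form x) + C * Real.exp (Φ.form x)) := by gcongr
        _ = _ := by ring
    rw [inv_pow, ← div_eq_mul_inv, le_div_iff₀ (by positivity)]
    refine hsum.trans ?_
    gcongr
    linarith

end ExpandingFlow

/-! ### Assembly. -/

theorem ExpStable.of_spectrum (hn : 1 ≤ n) {B : Matrix (Fin n) (Fin n) ℝ}
    (hB : ∀ z ∈ spectrum ℂ (B.map (fun r : ℝ => (r : ℂ))), z.re < 0) : ExpStable B :=
  have : Nonempty (Fin n) := ⟨⟨0, hn⟩⟩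
  B.exists_norm_exp_smul_le hB

theorem mehlerKernel_nonneg {Q B : Matrix (Fin n) (Fin n) ℝ} (hQ : Q.PosDef) (hB : ExpStable B)
    {t : ℝ} (ht : 0 < t) (x u : Rn n) : 0 ≤ mehlerKernel Q B t x u := by
  have h1 := (posDef_covInf hQ hB).det_pos
  have h2 := (posDef_covT hQ B ht).det_pos
  rw [mehlerKernel]
  positivity

/-- Reduction of the weak type inequality to probability measures in place of `|f| dμ`. -/
theorem weakType_of_probability {μ μ' : Measure (Rn n)} {k : Rn n → Rn n → ℝ≥0∞} {c : ℝ}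
    (hc : 0 ≤ c)
    (h : ∀ ν : Measure (Rn n), IsProbabilityMeasure ν → ∀ a : ℝ, 0 < a →
      μ' {x | ENNReal.ofReal a < ∫⁻ u, k x u ∂ν} ≤ ENNReal.ofReal (c / a)) (f : Rn n → ℂ)
    (hf : MemLp f 1 μ) {α : ℝ} (hα : 0 < α) :
    μ' {x | ENNReal.ofReal α < ∫⁻ u, k x u * ‖f u‖ₑ ∂μ} ≤
      ENNReal.ofReal c / ENNReal.ofReal α * eLpNorm f 1 μ := by
  have hI : eLpNorm f 1 μ = ∫⁻ u, ‖f u‖ₑ ∂μ := eLpNorm_one_eq_lintegral_enorm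
  have hItop : eLpNorm f 1 μ ≠ ⊤ := hf.2.ne
  have hfm : AEMeasurable (fun u => ‖f u‖ₑ) μ := hf.1.enorm
  set i := (eLpNorm f 1 μ).toReal with hi
  have hIi : eLpNorm f 1 μ = ENNReal.ofReal i := (ENNReal.ofReal_toReal hItop).symm
  rcases (ENNReal.toReal_nonneg : 0 ≤ i).eq_or_lt with h0 | hpos
  · have h1 : ∫⁻ u, ‖f u‖ₑ ∂μ = 0 := by rw [← hI, hIi, hi, ← h0, ENNReal.ofReal_zero]
    rw [lintegral_eq_zero_iff' hfm] at h1
    have h2 : ∀ x, ∫⁻ u, k x u * ‖f u‖ₑ ∂μ = 0 := fun x => by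
      rw [← lintegral_zero]
      refine lintegral_congr_ae ?_
      filter_upwards [h1] with u hu
      rw [hu]; simp
    simp [h2]
  · set ν := (ENNReal.ofReal i)⁻¹ • μ.withDensity (fun u => ‖f u‖ₑ) with hν
    have hi0 : ENNReal.ofReal i ≠ 0 := by simpa using hpos
    have hprob : IsProbabilityMeasure ν := ⟨by
      rw [hν, Measure.smul_apply, withDensity_apply _ MeasurableSet.univ, Measure.restrict_univ,
        ← hI, hIi, smul_eq_mul, ENNReal.inv_mul_cancel hi0 ENNReal.ofReal_ne_top]⟩
    have hint : ∀ x, ∫⁻ u, k x u * ‖f u‖ₑ ∂μ = ENNReal.ofReal i * ∫⁻ u, k x u ∂ν := by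
      intro x
      -- This form of the density rule asks for no measurability of k x in u; finiteness of the
      -- density replaces it.
      rw [hν, lintegral_smul_measure, lintegral_withDensity_eq_lintegral_mul_non_measurable₀ _ hfm
        (Filter.Eventually.of_forall fun u => enorm_lt_top), smul_eq_mul, ← mul_assoc,
        ENNReal.mul_inv_cancel hi0 ENNReal.ofReal_ne_top, one_mul]
      simp only [Pi.mul_apply, mul_comm]
    calc _ ≤ μ' {x | ENNReal.ofReal (α / i) < ∫⁻ u, k x u ∂ν} := by
          refine measure_mono fun x hx => ?_
          have hx' : ENNReal.ofReal α < ∫⁻ u, k x u * ‖f u‖ₑ ∂μ := hx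
          rw [hint] at hx'
          change ENNReal.ofReal (α / i) < _
          rw [ENNReal.ofReal_div_of_pos hpos]
          exact ENNReal.div_lt_of_lt_mul' hx'
      _ ≤ ENNReal.ofReal (c / (α / i)) := h ν hprob _ (by positivity)
      _ = _ := by
        rw [hIi, ← ENNReal.ofReal_div_of_pos hα, ← ENNReal.ofReal_mul (by positivity)]
        congr 1
        field_simp

end OrnsteinUhlenbeck
end

theorem theorem11p2 (n : ℕ) (hn : 1 ≤ n) (Q B : Matrix (Fin n) (Fin n) ℝ) (hQ : Q.PosDef)
    (hB : ∀ z ∈ spectrum ℂ (B.map (fun r : ℝ => (r : ℂ))), z.re < 0) :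
    ∃ C : ℝ≥0, ∀ L : OrnsteinUhlenbeck.Localization n,
      OrnsteinUhlenbeck.IsWeakType11 (OrnsteinUhlenbeck.gammaInf Q B)
        (OrnsteinUhlenbeck.Sglob Q B L) C := by
  open OrnsteinUhlenbeck MeasureTheory in
  have hstab : ExpStable B := ExpStable.of_spectrum hn hB
  obtain ⟨Φ, hform, hflow⟩ := exists_expandingFlow hQ hstab
  obtain ⟨C₀, hC₀, hK⟩ := exists_mehlerKernel_le hQ hstab
  obtain ⟨C₁, hC₁, hbd⟩ := Φ.exists_kernel_bounds hC₀
  obtain ⟨C, hC, hweak⟩ := Φ.exists_weight_lintegral_kernel_gt_le hC₁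
  set d : ℝ := (2 * Real.pi) ^ (-(n : ℝ) / 2) * (covInf Q B).det ^ (-(1 / 2) : ℝ) with hd
  have hdet := (posDef_covInf hQ hstab).det_pos
  have hd0 : 0 < d := by positivity
  have hgamma : gammaInf Q B = ENNReal.ofReal d • Φ.weight := by
    rw [gammaInf, ExpandingFlow.weight, ← withDensity_smul' _ _ ENNReal.ofReal_ne_top]
    congr 1
    ext x
    rw [Pi.smul_apply, smul_eq_mul, ← ENNReal.ofReal_mul hd0.le, hform]
  -- The constant is fixed before L: the localization enters below only through η ≥ 0 and the
  -- separation 1/10.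
  refine ⟨(d * C).toNNReal, fun L f hf α hα => ?_⟩
  set k : Rn n → Rn n → ℝ≥0∞ := fun x u =>
    (⨆ t : Set.Ioi (0 : ℝ), ENNReal.ofReal (mehlerKernel Q B t x u)) *
      ENNReal.ofReal (1 - L.eta x u) with hk
  have hone : ∀ x u, ENNReal.ofReal (1 - L.eta x u) ≤ 1 := fun x u => by
    rw [← ENNReal.ofReal_one]
    exact ENNReal.ofReal_le_ofReal (by linarith [L.eta_nonneg x u])
  have hkle : ∀ x u, ∀ b : ℝ≥0∞, (1 / 10 ≤ ‖x - u‖ * (1 + ‖x‖) →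
      ∀ t : Set.Ioi (0 : ℝ), ENNReal.ofReal (mehlerKernel Q B t x u) ≤ b) → k x u ≤ b := by
    intro x u b h
    by_cases heta : L.eta x u = 1
    · simp [hk, heta]
    · exact (mul_le_of_le_one_right' (hone x u)).trans
        (iSup_le (h (L.le_norm_sub_of_eta_ne_one heta)))
  have hbounds : ∀ x u, 1 / 10 ≤ ‖x - u‖ * (1 + ‖x‖) → ∀ t : Set.Ioi (0 : ℝ), _ :=
    fun x u h t => hbd t t.2 x u h (mehlerKernel Q B t x u) (mehlerKernel_nonneg hQ hstab t.2 x u)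
      (by rw [hform]; exact (hK t t.2 x u).1) (by rw [hform, hflow]; exact (hK t t.2 x u).2)
  have hprob := hweak k
    (fun x u => hkle x u _ fun h t => ENNReal.ofReal_le_ofReal (hbounds x u h t).1)
    (fun r hr x hx u => hkle x u _ fun h t => by
      refine (ENNReal.ofReal_le_ofReal ((hbounds x u h t).2 r hr hx)).trans ?_
      rw [ENNReal.ofReal_mul (by positivity)]
      gcongr
      exact le_iSup (fun t : Set.Ioi (0 : ℝ) =>
        ENNReal.ofReal ((r⁻¹ + ‖Φ.flow (-t) u - x‖)⁻¹ ^ n)) t)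
  -- The function is integrated against γ_∞ while the level set is measured by `weight`; the
  -- normalizing factor d thus enters exactly once.
  have hmain := weakType_of_probability hC.le hprob f hf hα
  calc gammaInf Q B {x | ENNReal.ofReal α < Sglob Q B L f x}
      = ENNReal.ofReal d * Φ.weight {x | ENNReal.ofReal α < ∫⁻ u, k x u * ‖f u‖ₑ ∂gammaInf Q B} := by
        nth_rewrite 1 [hgamma]
        rfl
    _ ≤ ENNReal.ofReal d *
        (ENNReal.ofReal C / ENNReal.ofReal α * eLpNorm f 1 (gammaInf Q B)) := by gcongr
    _ = _ := by
      rw [← mul_assoc, ← mul_div_assoc, ← ENNReal.ofReal_mul hd0.le]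
      rfl
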